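/- Let $M$ be a compact connected smooth manifold (possibly with boundary), let $d$ be a metric on $M$ inducing its topology, and let $m$ be a Lebesgue probability on $M$, that is, a Borel probability measure with a positive continuous density with respect to Lebesgue measure in every chart (for instance, the normalized volume of a Riemannian metric). Let $X=M^{\mathbb N}$ with the product topology and the distance $d(x,y)=\sum_{n\ge 0}2^{-(n+1)}d(x_n,y_n)$, let $\sigma(x_0,x_1,x_2,\dots)=(x_1,x_2,\dots)$ be the shift on $X$, and for $a\in M$, $x\in X$ write $ax=(a,x_0,x_1,\dots)$. Let $f:X\to\mathbb R$ be Hölder continuous. Let $\beta(f)=\max_\mu\int f\,d\mu$, the maximum being over the $\sigma$-invariant Borel probability measures $\mu$ on $X$; a measure attaining it is called a maximizing probability for $f$. A calibrated subaction for $f$ is a continuous function $V:X\to\mathbb R$ with $V(y)=\max_{\sigma(x)=y}[f(x)+V(x)-\beta(f)]$ for all $y\in X$. For $c>0$ let $L_{cf}w(x)=\int_M e^{cf(ax)}w(ax)\,dm(a)$ be the Ruelle operator on continuous functions $w$, and let $\mu_c=h_c\nu_c$ be the Gibbs probability of $cf$, where, for an eigenvalue $\beta_c>0$, $h_c$ is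 a positive continuous function with $L_{cf}h_c=\beta_ch_c$, $\nu_c$ is a Borel probability measure on $X$ with $L_{cf}^*\nu_c=\beta_c\nu_c$, and $\int h_c\,d\nu_c=1$. Theorem. Suppose that the maximizing probability for $f$ is unique. Let $V$ be any calibrated subaction for $f$, and put $R_+=\beta(f)+V\circ\sigma-V-f\ge 0$ and $R_+^\infty=\sum_{j=0}^\infty R_+\circ\sigma^j: X\to[0,\infty]$. Then for every closed set $F\subseteq X$ and every open set $A\subseteq X$ $$\limsup_{c\to\infty}\frac1c\log\mu_c(F)\le-\inf_{x\in F}R_+^\infty(x),\qquad \liminf_{c\to\infty}\frac1c\log\mu_c(A)\ge-\inf_{x\in A}R_+^\infty(x),$$ with the conventions $\log 0=-\infty$ and $\inf\emptyset=+\infty$. Moreover, $R_+^\infty$ is lower semicontinuous and, if $M$ has more than one point, it takes the value $+\infty$ at some point of $X$. -/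

import Mathlib

open MeasureTheory Filter Topology
open scoped ENNReal Manifold ContDiff

namespace XYModel

/-- The left shift `σ(x₀, x₁, x₂, …) = (x₁, x₂, …)` on `X = M^ℕ`. -/
def shift {M : Type*} (x : ℕ → M) : ℕ → M := fun n => x (n + 1)

/-- The sequence `a x = (a, x₀, x₁, …)`. -/
def prepend {M : Type*} (a : M) (x : ℕ → M) : ℕ → M
  | 0 => a
  | n + 1 => x n

/-- The distance `∑ₙ 2^{-(n+1)} d(xₙ, yₙ)` on `X = M^ℕ` induced by the distance of the compact
space `M`. -/
noncomputable def seqDist {M : Type*} [MetricSpace M] (x y : ℕ → M) : ℝ :=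
  ∑' n : ℕ, (1 / 2 : ℝ) ^ (n + 1) * dist (x n) (y n)

/-- Hölder functions on `X = M^ℕ`. -/
def IsHolder {M : Type*} [MetricSpace M] (f : (ℕ → M) → ℝ) : Prop :=
  ∃ C α : ℝ, 0 < α ∧ α ≤ 1 ∧ ∀ x y, |f x - f y| ≤ C * seqDist x y ^ α

/-- `m` is a Lebesgue probability on the manifold `M`: in each of the preferred charts
it has a positive continuous density with respect to Lebesgue measure. -/
def IsLebesgueProbability {k : ℕ} {H : Type*} [TopologicalSpace H]
    (I : ModelWithCorners ℝ (EuclideanSpace ℝ (Fin k)) H) {M : Type*} [TopologicalSpace M]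
    [ChartedSpace H M] [MeasurableSpace M] (m : Measure M) : Prop :=
  IsProbabilityMeasure m ∧
    ∀ x : M, ∃ ρ : EuclideanSpace ℝ (Fin k) → ℝ,
      ContinuousOn ρ (extChartAt I x).target ∧ (∀ u ∈ (extChartAt I x).target, 0 < ρ u) ∧
      (m.restrict (extChartAt I x).source).map (extChartAt I x) =
        (volume.restrict (extChartAt I x).target).withDensity (fun u => ENNReal.ofReal (ρ u))

section Dynamics

variable {M : Type*} [MeasurableSpace M]

/-- The Ruelle operator `L_f w (x) = ∫ e^{f(ax)} w(ax) dm(a)`. -/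
noncomputable def ruelle (m : Measure M) (f w : (ℕ → M) → ℝ) (x : ℕ → M) : ℝ :=
  ∫ a, Real.exp (f (prepend a x)) * w (prepend a x) ∂m

/-- `μ` is the Gibbs probability `μ = h ν` of the potential `f`: `h` is a positive continuous
eigenfunction of `L_f`, `ν` is an eigenprobability of the dual operator `L_f^*` for the same
eigenvalue, and `h` is normalized by `∫ h dν = 1`. -/
def IsGibbs [TopologicalSpace M] (m : Measure M) (f : (ℕ → M) → ℝ)
    (μ : Measure (ℕ → M)) : Prop :=
  ∃ (lam : ℝ) (h : (ℕ → M) → ℝ) (ν : Measure (ℕ → M)),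
    0 < lam ∧
    Continuous h ∧ (∀ x, 0 < h x) ∧ (∀ x, ruelle m f h x = lam * h x) ∧
    IsProbabilityMeasure ν ∧
    (∀ w : (ℕ → M) → ℝ, Continuous w → ∫ x, ruelle m f w x ∂ν = lam * ∫ x, w x ∂ν) ∧
    ∫ x, h x ∂ν = 1 ∧
    μ = ν.withDensity (fun x => ENNReal.ofReal (h x))

/-- The set of shift-invariant Borel probability measures on `X = M^ℕ`. -/
def invariantProbabilities (M : Type*) [MeasurableSpace M] : Set (Measure (ℕ → M)) :=
  {μ | IsProbabilityMeasure μ ∧ MeasurePreserving shift μ μ}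

/-- `β(f)`, the maximal value of `∫ f dμ` over the invariant probabilities `μ`. -/
noncomputable def maxMean (f : (ℕ → M) → ℝ) : ℝ :=
  sSup ((fun μ : Measure (ℕ → M) => ∫ x, f x ∂μ) '' invariantProbabilities M)

/-- `μ` is a maximizing probability measure for `f`. -/
def IsMaximizing (f : (ℕ → M) → ℝ) (μ : Measure (ℕ → M)) : Prop :=
  μ ∈ invariantProbabilities M ∧ ∫ x, f x ∂μ = maxMean f

/-- `V` is a calibrated subaction for `f`: it is continuous and
`V(y) = max_{σ(x) = y} [f(x) + V(x) - β(f)]` for every `y`. -/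
def IsCalibratedSubaction [TopologicalSpace M] (f V : (ℕ → M) → ℝ) : Prop :=
  Continuous V ∧
    ∀ y, IsGreatest ((fun x => f x + V x - maxMean f) '' {x | shift x = y}) (V y)

/-- `R₊ = β(f) + V ∘ σ - V - f`. -/
noncomputable def Rplus (f V : (ℕ → M) → ℝ) (x : ℕ → M) : ℝ :=
  maxMean f + V (shift x) - V x - f x

/-- `R₊` is nonnegative, so that the truncation in `rate` below has no effect. -/
theorem Rplus_nonneg [TopologicalSpace M] {f V : (ℕ → M) → ℝ}
    (hV : IsCalibratedSubaction f V) (x : ℕ → M) : 0 ≤ Rplus f V x := by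
  have h := (hV.2 (shift x)).2 ⟨x, rfl, rfl⟩
  unfold Rplus
  simp only at h
  linarith

/-- The deviation function `R₊^∞ = ∑_{j ≥ 0} R₊ ∘ σ^j`, with values in `[0, ∞]`. -/
noncomputable def rate (f V : (ℕ → M) → ℝ) (x : ℕ → M) : ℝ≥0∞ :=
  ∑' j : ℕ, ENNReal.ofReal (Rplus f V (shift^[j] x))

end Dynamics

end XYModel

/-! With `u = log h_c` and `s = log β_c`, put `g_c = c f + u - u ∘ σ - s`. Then `exp g_c(ax)` is a
probability density in `a`, and `μ_c` is stationary for the transfer operator with weight `exp g_c`.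
Iterating `n` times, `μ_c` of a set is at most the supremum of `exp (S_n g_c)` over it, and `μ_c` of
a cylinder over a tail set `U` is bounded below by a product of `m`-masses times `μ_c U` times the
infimum of `exp (S_n g_c)`.

The heart is that `g_c / c → -R₊` uniformly (`eventually_abs_normalized_add_Rplus_le`). The
functions `u / c` share one Hölder modulus, so along every ultrafilter tending to infinity they
converge, up to constants, to a calibrated subaction. When the maximizing probability is unique, two
calibrated subactions differ by a constant (`calibrated_sub_const`), so every limit gives the same
`R₊`.

Upper bound: the sums `S_n R₊` increase to the rate, and compactness of `F` lets a single `n` serve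
all of `F`. Lower bound: an orbit of finite rate has bounded sums of `R₊`, so its empirical measures
accumulate at the maximizing probability `P`, and the orbit enters any small ball `U` around a point
of the support of `P`, at some time `N`. Sequences close to `x` up to time `N` and lying in `U` at
time `N` have nearly the same `S_N R₊`, by bounded distortion; their mass is not exponentially
small, because `μ_c` converges weakly to `P`. -/

namespace XYModel

/-! ### The shift and its inverse branches. -/

section Sequences

variable {M : Type*}

theorem shift_prepend (a : M) (x : ℕ → M) : shift (prepend a x) = x := rfl

theorem prepend_shift (x : ℕ → M) : prepend (x 0) (shift x) = x := by
  funext n; cases n <;> rfl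

theorem shift_iterate_apply (N : ℕ) (x : ℕ → M) (n : ℕ) : shift^[N] x n = x (n + N) := by
  induction N generalizing x with
  | zero => rfl
  | succ N ih =>
    rw [Function.iterate_succ_apply, ih]
    show x (n + N + 1) = _
    rfl

variable [TopologicalSpace M]

theorem continuous_shift : Continuous (shift : (ℕ → M) → ℕ → M) :=
  continuous_pi fun n => continuous_apply (n + 1)

theorem continuous_prepend : Continuous fun p : M × (ℕ → M) => prepend p.1 p.2 := by
  refine continuous_pi fun n => ?_
  cases n with
  | zero => exact continuous_fst
  | succ n => exact (continuous_apply n).comp continuous_snd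

theorem continuous_prepend_left (x : ℕ → M) : Continuous fun a : M => prepend a x :=
  continuous_prepend.comp (Continuous.prodMk_left x)

end Sequences

/-! ### The metric on sequences and bounded distortion. -/

/-- The constant `∑_{k ≥ 1} 2^{-kα}`. -/
noncomputable def distortionConst (α : ℝ) : ℝ := ((2 : ℝ) ^ α - 1)⁻¹

theorem distortionConst_pos {α : ℝ} (hα : 0 < α) : 0 < distortionConst α :=
  inv_pos.2 (sub_pos.2 (Real.one_lt_rpow one_lt_two hα))

/-- The identity that closes the inductions below: the error of one step plus the error accumulated
after halving the distance is again the accumulated error. -/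
theorem distortionConst_spec {α : ℝ} (hα : 0 < α) :
    1 + distortionConst α = 2 ^ α * distortionConst α := by
  have : (2 : ℝ) ^ α - 1 ≠ 0 := (sub_pos.2 (Real.one_lt_rpow one_lt_two hα)).ne'
  unfold distortionConst
  field_simp
  ring

theorem two_rpow_mul_half_rpow {α d : ℝ} (hd : 0 ≤ d) :
    (2 : ℝ) ^ α * (1 / 2 * d) ^ α = d ^ α := by
  rw [← Real.mul_rpow (by norm_num) (by positivity)]
  congr 1
  ring

section Distance

variable {M : Type*} [MetricSpace M]

theorem seqDist_nonneg (x y : ℕ → M) : 0 ≤ seqDist x y :=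
  tsum_nonneg fun n => by positivity

theorem seqDist_self (x : ℕ → M) : seqDist x x = 0 := by simp [seqDist]

theorem seqDist_comm (x y : ℕ → M) : seqDist x y = seqDist y x := by
  simp only [seqDist, dist_comm]

variable [CompactSpace M]

theorem dist_le_diam_univ (a b : M) : dist a b ≤ Metric.diam (Set.univ : Set M) :=
  Metric.dist_le_diam_of_mem isCompact_univ.isBounded (Set.mem_univ a) (Set.mem_univ b)

theorem summable_half_pow_mul (C : ℝ) : Summable fun n : ℕ => (1 / 2 : ℝ) ^ (n + 1) * C := by
  simp_rw [pow_succ, mul_assoc]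
  exact summable_geometric_two.mul_right _

theorem tsum_half_pow_mul (C : ℝ) : ∑' n : ℕ, (1 / 2 : ℝ) ^ (n + 1) * C = C := by
  simp_rw [pow_succ, mul_assoc]
  rw [tsum_mul_right, tsum_geometric_two]
  ring

theorem seqDist_summable (x y : ℕ → M) :
    Summable fun n : ℕ => (1 / 2 : ℝ) ^ (n + 1) * dist (x n) (y n) :=
  Summable.of_nonneg_of_le (fun n => by positivity)
    (fun n => mul_le_mul_of_nonneg_left (dist_le_diam_univ _ _) (by positivity))
    (summable_half_pow_mul (Metric.diam (Set.univ : Set M)))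

theorem seqDist_triangle (x y z : ℕ → M) : seqDist x z ≤ seqDist x y + seqDist y z := by
  unfold seqDist
  rw [← (seqDist_summable x y).tsum_add (seqDist_summable y z)]
  refine (seqDist_summable x z).tsum_le_tsum (fun n => ?_)
    ((seqDist_summable x y).add (seqDist_summable y z))
  rw [← mul_add]
  exact mul_le_mul_of_nonneg_left (dist_triangle _ _ _) (by positivity)

theorem seqDist_le_of_forall {x y : ℕ → M} {r : ℝ} (h : ∀ n, dist (x n) (y n) ≤ r) :
    seqDist x y ≤ r := by
  rw [← tsum_half_pow_mul r]
  exact (seqDist_summable x y).tsum_le_tsum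
    (fun n => mul_le_mul_of_nonneg_left (h n) (by positivity)) (summable_half_pow_mul r)

theorem seqDist_le_diam (x y : ℕ → M) : seqDist x y ≤ Metric.diam (Set.univ : Set M) :=
  seqDist_le_of_forall fun _ => dist_le_diam_univ _ _

theorem eq_of_seqDist_eq_zero {x y : ℕ → M} (h : seqDist x y = 0) : x = y := by
  funext n
  have h0 := (seqDist_summable x y).hasSum
  rw [← seqDist, h, hasSum_zero_iff_of_nonneg fun n => by positivity] at h0
  simpa using congrFun h0 n

theorem continuous_seqDist : Continuous fun p : (ℕ → M) × (ℕ → M) => seqDist p.1 p.2 := by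
  refine continuous_tsum (u := fun n : ℕ => (1 / 2 : ℝ) ^ (n + 1) *
    Metric.diam (Set.univ : Set M)) (fun n => by fun_prop) (summable_half_pow_mul _) ?_
  intro n p
  rw [Real.norm_of_nonneg (by positivity)]
  exact mul_le_mul_of_nonneg_left (dist_le_diam_univ _ _) (by positivity)

theorem seqDist_eq_half_shift {x y : ℕ → M} (h : x 0 = y 0) :
    seqDist x y = 1 / 2 * seqDist (shift x) (shift y) := by
  unfold seqDist
  rw [(seqDist_summable x y).tsum_eq_zero_add, ← tsum_mul_left]
  simp only [h, dist_self, mul_zero, zero_add, shift]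
  congr 1
  funext n
  ring

theorem seqDist_prepend (a : M) (x y : ℕ → M) :
    seqDist (prepend a x) (prepend a y) = 1 / 2 * seqDist x y :=
  seqDist_eq_half_shift rfl

/-- A closed subset of `X × X` that misses the diagonal has positive `seqDist`-distance to it. -/
theorem exists_pos_le_seqDist {K : Set ((ℕ → M) × (ℕ → M))} (hK : IsClosed K)
    (h : ∀ x, (x, x) ∉ K) : ∃ δ > 0, ∀ x y, (x, y) ∈ K → δ ≤ seqDist x y := by
  rcases K.eq_empty_or_nonempty with rfl | hne
  · exact ⟨1, one_pos, fun _ _ h => h.elim⟩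
  obtain ⟨p, hp, hmin⟩ := hK.isCompact.exists_isMinOn hne continuous_seqDist.continuousOn
  refine ⟨seqDist p.1 p.2, lt_of_le_of_ne (seqDist_nonneg _ _) fun h0 => ?_,
    fun x y hxy => hmin hxy⟩
  have := eq_of_seqDist_eq_zero h0.symm
  exact h p.1 (by rw [show (p.1, p.1) = p from Prod.ext rfl this]; exact hp)

theorem exists_seqDist_lt_imp_abs_sub_lt {w : (ℕ → M) → ℝ} (hw : Continuous w) {ε : ℝ}
    (hε : 0 < ε) : ∃ δ > 0, ∀ x y, seqDist x y < δ → |w x - w y| < ε := by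
  obtain ⟨δ, hδ, h⟩ := exists_pos_le_seqDist
    (K := {p : (ℕ → M) × (ℕ → M) | ε ≤ |w p.1 - w p.2|})
    (isClosed_le continuous_const (by fun_prop)) (fun x => by simpa using hε)
  refine ⟨δ, hδ, fun x y hxy => ?_⟩
  by_contra hc
  exact absurd (h x y (not_lt.1 hc)) (not_le.2 hxy)

theorem exists_seqDist_lt_imp_mem {A : Set (ℕ → M)} (hA : IsOpen A) {x : ℕ → M} (hx : x ∈ A) :
    ∃ δ > 0, ∀ y, seqDist x y < δ → y ∈ A := by
  obtain ⟨δ, hδ, h⟩ := exists_pos_le_seqDist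
    (K := {p : (ℕ → M) × (ℕ → M) | p.1 = x} ∩ {p | p.2 ∈ Aᶜ})
    ((isClosed_eq continuous_fst continuous_const).inter
      (hA.isClosed_compl.preimage continuous_snd))
    (fun z hz => hz.2 (by rw [show z = x from hz.1]; exact hx))
  refine ⟨δ, hδ, fun y hxy => ?_⟩
  by_contra hc
  exact absurd (h x y ⟨rfl, hc⟩) (not_le.2 hxy)

theorem continuous_of_isHolder {f : (ℕ → M) → ℝ} (hf : IsHolder f) : Continuous f := by
  obtain ⟨C, α, hα, -, h⟩ := hf
  refine continuous_iff_continuousAt.2 fun x => ?_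
  rw [ContinuousAt, tendsto_iff_dist_tendsto_zero]
  have hc : Continuous fun y => C * seqDist y x ^ α :=
    continuous_const.mul ((continuous_seqDist.comp
      (Continuous.prodMk_left x)).rpow_const fun _ => Or.inr hα.le)
  have h0 : Tendsto (fun y => C * seqDist y x ^ α) (𝓝 x) (𝓝 0) := by
    have := hc.tendsto x
    simpa [seqDist_self, Real.zero_rpow hα.ne'] using this
  exact squeeze_zero (fun _ => dist_nonneg) (fun y => h y x) h0

/-- Bounded distortion of the Birkhoff sums of a Hölder function. -/
theorem birkhoffSum_sub_le {f : (ℕ → M) → ℝ} {C α : ℝ} (hα : 0 < α)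
    (hf : ∀ x y, |f x - f y| ≤ C * seqDist x y ^ α) (N : ℕ) :
    ∀ x y : ℕ → M, (∀ i < N, x i = y i) →
      |birkhoffSum shift f N x - birkhoffSum shift f N y| ≤
        C * distortionConst α * (seqDist (shift^[N] x) (shift^[N] y) ^ α - seqDist x y ^ α) := by
  induction N with
  | zero => intro x y _; simp
  | succ N ih =>
    intro x y h
    have h1 := ih (shift x) (shift y) fun i hi => h (i + 1) (by omega)
    have h2 := seqDist_eq_half_shift (h 0 (by omega))
    -- The subtracted term `seqDist x y ^ α` makes the bound telescope, whence a constant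
    -- independent of `N`.
    have h3 := two_rpow_mul_half_rpow (α := α) (seqDist_nonneg (shift x) (shift y))
    rw [← h2] at h3
    rw [← h3] at h1
    have h4 := hf x y
    rw [birkhoffSum_succ', birkhoffSum_succ', Function.iterate_succ_apply,
      Function.iterate_succ_apply]
    have h5 := distortionConst_spec hα
    calc _ = |(f x - f y) +
            (birkhoffSum shift f N (shift x) - birkhoffSum shift f N (shift y))| := by
          congr 1; ring
      _ ≤ |f x - f y| + _ := abs_add_le _ _
      _ ≤ _ := by
          have : C * distortionConst α * (2 ^ α * seqDist x y ^ α) =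
            C * seqDist x y ^ α + C * distortionConst α * seqDist x y ^ α := by
            calc _ = C * (2 ^ α * distortionConst α) * seqDist x y ^ α := by ring
              _ = _ := by rw [← h5]; ring
          rw [mul_sub] at h1 ⊢
          linarith

end Distance

/-! ### Lebesgue probabilities charge open sets. -/

section FullSupport

/-- A point may lie on the boundary, where the chart image of `U` is only relatively open in the
range of `I`. That range lies in the closure of its interior, so the image contains a nonempty open
set `S`, on which the density is positive. -/
theorem IsLebesgueProbability.isOpenPosMeasure {k : ℕ} {H : Type*} [TopologicalSpace H]
    {I : ModelWithCorners ℝ (EuclideanSpace ℝ (Fin k)) H} {M : Type*} [TopologicalSpace M]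
    [ChartedSpace H M] [MeasurableSpace M] [BorelSpace M] {m : Measure M}
    (hm : IsLebesgueProbability I m) : m.IsOpenPosMeasure := by
  refine ⟨fun U hU ⟨x, hx⟩ h0 => ?_⟩
  obtain ⟨ρ, hρc, hρ, hmap⟩ := hm.2 x
  set φ := extChartAt I x with hφ
  have hmem : φ.target ∩ φ.symm ⁻¹' U ∈ 𝓝[Set.range I] (φ x) := by
    refine inter_mem (extChartAt_target_mem_nhdsWithin x) ?_
    exact (continuousAt_extChartAt_symm x).continuousWithinAt
      (by rw [extChartAt_to_inv]; exact hU.mem_nhds hx)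
  obtain ⟨W, hWo, hxW, hW⟩ := mem_nhdsWithin.1 hmem
  set S := W ∩ interior (Set.range I) with hS
  have hSo : IsOpen S := hWo.inter isOpen_interior
  have hSne : S.Nonempty :=
    mem_closure_iff.1 (I.range_subset_closure_interior (extChartAt_target_subset_range x
      (mem_extChartAt_target x))) W hWo hxW
  have hSsub : S ⊆ φ.target ∩ φ.symm ⁻¹' U := fun z hz => hW ⟨hz.1, interior_subset hz.2⟩
  have hae : AEMeasurable φ (m.restrict φ.source) :=
    (continuousOn_extChartAt x).aemeasurable (isOpen_extChartAt_source x).measurableSet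
  have h1 : ((m.restrict φ.source).map φ) S = 0 := by
    rw [Measure.map_apply_of_aemeasurable hae hSo.measurableSet,
      Measure.restrict_apply₀' (isOpen_extChartAt_source x).measurableSet.nullMeasurableSet]
    refine measure_mono_null (fun z hz => ?_) h0
    have := (hSsub hz.1).2
    rwa [Set.mem_preimage, φ.left_inv hz.2] at this
  rw [hmap, withDensity_apply _ hSo.measurableSet,
    Measure.restrict_restrict_of_subset (fun z hz => (hSsub hz).1)] at h1
  have h2 := (lintegral_eq_zero_iff' ?_).1 h1
  · have h3 : ∀ᵐ u ∂(volume.restrict S), False := by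
      filter_upwards [h2, ae_restrict_mem hSo.measurableSet] with u hu huS
      have := hρ u (hSsub huS).1
      simp only [Pi.zero_apply, ENNReal.ofReal_eq_zero] at hu
      linarith
    rw [Filter.eventually_false_iff_eq_bot, ae_eq_bot, Measure.restrict_eq_zero] at h3
    exact (hSo.measure_pos volume hSne).ne' h3
  · exact (hρc.mono fun z hz => (hSsub hz).1).aemeasurable hSo.measurableSet |>.ennreal_ofReal

end FullSupport

/-! ### Gibbs measures through normalized potentials. -/

/-- The potential `φ + u - u ∘ σ - s`, cohomologous to `φ - s`. -/
def normalized {M : Type*} (φ u : (ℕ → M) → ℝ) (s : ℝ) (z : ℕ → M) : ℝ :=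
  φ z + u z - u (shift z) - s

section Gibbs

variable {M : Type*} [MetricSpace M]

theorem continuous_normalized {φ u : (ℕ → M) → ℝ} (hφ : Continuous φ) (hu : Continuous u) (s : ℝ) :
    Continuous (normalized φ u s) :=
  ((hφ.add hu).sub (hu.comp continuous_shift)).sub continuous_const

theorem integrable_of_continuous {Ω : Type*} [TopologicalSpace Ω] [CompactSpace Ω]
    [MeasurableSpace Ω] [OpensMeasurableSpace Ω] {w : Ω → ℝ} (hw : Continuous w) (μ : Measure Ω)
    [IsFiniteMeasure μ] : Integrable w μ :=
  BoundedContinuousFunction.integrable μ (BoundedContinuousFunction.mkOfCompact ⟨w, hw⟩)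

theorem integral_withDensity_ofReal {Ω : Type*} [MeasurableSpace Ω] {ν : Measure Ω} {h : Ω → ℝ}
    (hh : Measurable h) (hpos : ∀ x, 0 < h x) (w : Ω → ℝ) :
    ∫ x, w x ∂(ν.withDensity fun x => ENNReal.ofReal (h x)) = ∫ x, h x * w x ∂ν := by
  rw [integral_withDensity_eq_integral_toReal_smul hh.ennreal_ofReal (by simp)]
  simp [ENNReal.toReal_ofReal (hpos _).le]

theorem isFiniteMeasure_withDensity_ofReal_of_continuous {Ω : Type*} [TopologicalSpace Ω]
    [CompactSpace Ω] [MeasurableSpace Ω] [OpensMeasurableSpace Ω] {ν : Measure Ω}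
    [IsFiniteMeasure ν] {h : Ω → ℝ} (hh : Continuous h) :
    IsFiniteMeasure (ν.withDensity fun x => ENNReal.ofReal (h x)) :=
  isFiniteMeasure_withDensity_ofReal (integrable_of_continuous hh ν).hasFiniteIntegral

/-- `μ` is stationary for the transfer operator with weight `exp g`. -/
def IsStationary [MeasurableSpace M] (m : Measure M) (g : (ℕ → M) → ℝ) (μ : Measure (ℕ → M)) :
    Prop :=
  ∀ ψ : (ℕ → M) → ℝ≥0∞, Measurable ψ → ∫⁻ x, ψ x ∂μ =
    ∫⁻ x, ∫⁻ a, ENNReal.ofReal (Real.exp (g (prepend a x))) * ψ (prepend a x) ∂m ∂μ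

/-- Induction step for iterating stationarity: the weight `exp (S_n g)` absorbs one application of
the transfer operator. -/
theorem exp_birkhoffSum_mul_transfer {M : Type*} [MeasurableSpace M] {m : Measure M}
    {g : (ℕ → M) → ℝ} (n : ℕ) (ψ : (ℕ → M) → ℝ≥0∞) (x : ℕ → M) :
    ENNReal.ofReal (Real.exp (birkhoffSum shift g n x)) *
      ∫⁻ a, ENNReal.ofReal (Real.exp (g (prepend a x))) * ψ (prepend a x) ∂m =
    ∫⁻ a, ENNReal.ofReal (Real.exp (birkhoffSum shift g (n + 1) (prepend a x))) *
      ψ (prepend a x) ∂m := by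
  rw [← lintegral_const_mul' _ _ ENNReal.ofReal_ne_top]
  congr 1
  funext a
  rw [birkhoffSum_succ', shift_prepend, add_comm, Real.exp_add,
    ENNReal.ofReal_mul (Real.exp_pos _).le, mul_assoc]

variable [CompactSpace M] [MeasurableSpace M] [BorelSpace M] {m : Measure M} {φ : (ℕ → M) → ℝ}
  {μ : Measure (ℕ → M)}

theorem measure_ext_of_continuous {P Q : Measure (ℕ → M)} [IsFiniteMeasure P] [IsFiniteMeasure Q]
    (h : ∀ w : (ℕ → M) → ℝ, Continuous w → ∫ x, w x ∂P = ∫ x, w x ∂Q) : P = Q :=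
  ext_of_forall_integral_eq_of_IsFiniteMeasure fun w => h w w.continuous

/-- The defining properties of a Gibbs measure, in terms of `u = log h` and `s = log λ`. -/
theorem IsGibbs.exists_normalized [IsProbabilityMeasure m] (hφ : Continuous φ)
    (hμ : IsGibbs m φ μ) :
    ∃ (u : (ℕ → M) → ℝ) (s : ℝ), Continuous u ∧
      (∀ x, ∫ a, Real.exp (φ (prepend a x) + u (prepend a x)) ∂m = Real.exp (u x + s)) ∧
      IsProbabilityMeasure μ ∧
      (∀ w : (ℕ → M) → ℝ, Continuous w → ∫ x, w (shift x) ∂μ = ∫ x, w x ∂μ) ∧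
      IsStationary m (normalized φ u s) μ := by
  obtain ⟨lam, h, ν, hlam, hc, hpos, heig, hν, hdual, hint, rfl⟩ := hμ
  set μ := ν.withDensity fun x => ENNReal.ofReal (h x) with hμ
  set u : (ℕ → M) → ℝ := fun x => Real.log (h x) with hu
  set s : ℝ := Real.log lam with hs
  have huc : Continuous u := hc.log fun x => (hpos x).ne'
  have hexpu : ∀ x, Real.exp (u x) = h x := fun x => Real.exp_log (hpos x)
  have hexps : Real.exp s = lam := Real.exp_log hlam
  have hfin : IsFiniteMeasure μ := isFiniteMeasure_withDensity_ofReal_of_continuous hc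
  have hI : ∀ w : (ℕ → M) → ℝ, ∫ x, w x ∂μ = ∫ x, h x * w x ∂ν :=
    integral_withDensity_ofReal hc.measurable hpos
  have hprob : IsProbabilityMeasure μ := by
    have h1 := hI fun _ => 1
    simp only [mul_one, hint, integral_const, smul_eq_mul] at h1
    refine ⟨?_⟩
    rw [← ENNReal.toReal_eq_one_iff]
    exact h1
  refine ⟨u, s, huc, fun x => ?_, hprob, fun w hw => ?_, fun ψ hψ => ?_⟩
  · rw [Real.exp_add, hexpu, hexps, mul_comm, ← heig]
    simp only [ruelle, Real.exp_add, hexpu]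
  · rw [hI, hI]
    -- The factor `lam` is restored so that duality applies, together with `L(h · w ∘ σ) = w · L h =
    -- lam · h · w`.
    refine mul_left_cancel₀ hlam.ne' ?_
    rw [← hdual (fun x => h x * w (shift x)) (hc.mul (hw.comp continuous_shift)),
      ← integral_const_mul]
    congr 1
    funext x
    rw [← mul_assoc, ← heig]
    simp only [ruelle, shift_prepend, ← mul_assoc, integral_mul_const]
  · set pre : (ℕ → M) × M → (ℕ → M) := fun p => prepend p.2 p.1 with hpre
    have hprec : Continuous pre := continuous_prepend.comp continuous_swap
    have hg := continuous_normalized hφ huc s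
    set D : (ℕ → M) × M → ℝ := fun p => Real.exp (normalized φ u s (pre p)) with hD
    have hDc : Continuous D := (hg.comp hprec).rexp
    have hDfin : IsFiniteMeasure ((μ.prod m).withDensity fun p => ENNReal.ofReal (D p)) :=
      isFiniteMeasure_withDensity_ofReal_of_continuous hDc
    -- Duality only tests continuous functions. Stating stationarity as an equality of finite
    -- measures extends it to all measurable `ψ`.
    have key : μ = ((μ.prod m).withDensity fun p => ENNReal.ofReal (D p)).map pre := by
      refine measure_ext_of_continuous fun w hw => ?_
      rw [integral_map hprec.measurable.aemeasurable hw.aestronglyMeasurable,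
        integral_withDensity_ofReal hDc.measurable (fun p => Real.exp_pos _),
        integral_prod (fun p => D p * w (pre p))
          (integrable_of_continuous (hDc.mul (hw.comp hprec)) _), hI, hI]
      refine mul_left_cancel₀ hlam.ne' ?_
      rw [← hdual (fun x => h x * w x) (hc.mul hw), ← integral_const_mul]
      congr 1
      funext x
      rw [← mul_assoc, ← integral_const_mul]
      unfold ruelle
      congr 1
      funext a
      simp only [hD, hpre, normalized, shift_prepend, Real.exp_sub, Real.exp_add, hexpu, hexps]
      have := (hpos x).ne'
      field_simp
    conv_lhs => rw [key]
    have hψp : Measurable fun p => ψ (pre p) := hψ.comp hprec.measurable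
    rw [lintegral_map hψ hprec.measurable, lintegral_withDensity_eq_lintegral_mul _
      hDc.measurable.ennreal_ofReal hψp, lintegral_prod]
    · rfl
    · exact (hDc.measurable.ennreal_ofReal.mul (hψ.comp hprec.measurable)).aemeasurable

/-! ### Mass estimates from iterated stationarity. -/

section Transfer

variable {g : (ℕ → M) → ℝ}

theorem measurable_transfer [SFinite m] (hg : Continuous g) {ψ : (ℕ → M) → ℝ≥0∞}
    (hψ : Measurable ψ) :
    Measurable fun x =>
      ∫⁻ a, ENNReal.ofReal (Real.exp (g (prepend a x))) * ψ (prepend a x) ∂m := by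
  have hpre : Measurable fun p : (ℕ → M) × M => prepend p.2 p.1 :=
    (continuous_prepend.comp continuous_swap).measurable
  exact (((hg.rexp.measurable.comp hpre).ennreal_ofReal).mul
    (hψ.comp hpre)).lintegral_prod_right'

theorem lintegral_le_of_exp_birkhoffSum_mul_le [IsProbabilityMeasure m] [IsProbabilityMeasure μ]
    (hstat : IsStationary m g μ) (hg : Continuous g) (n : ℕ) :
    ∀ (ψ : (ℕ → M) → ℝ≥0∞) (K : ℝ≥0∞), Measurable ψ →
      (∀ x, ENNReal.ofReal (Real.exp (birkhoffSum shift g n x)) * ψ x ≤ K) →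
      ∫⁻ x, ψ x ∂μ ≤ K := by
  induction n with
  | zero =>
    intro ψ K _ h
    calc ∫⁻ x, ψ x ∂μ ≤ ∫⁻ _, K ∂μ := lintegral_mono fun x => by simpa using h x
      _ = K := by simp
  | succ n ih =>
    intro ψ K hψ h
    rw [hstat ψ hψ]
    refine ih _ K (measurable_transfer hg hψ) fun x => ?_
    rw [exp_birkhoffSum_mul_transfer]
    calc _ ≤ ∫⁻ _, K ∂m := lintegral_mono fun a => h _
      _ = K := by simp

theorem measure_le_exp [IsProbabilityMeasure m] [IsProbabilityMeasure μ]
    (hstat : IsStationary m g μ) (hg : Continuous g) (n : ℕ) {B : Set (ℕ → M)}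
    (hB : MeasurableSet B) {t : ℝ}
    (h : ∀ x ∈ B, birkhoffSum shift g n x ≤ t) : μ B ≤ ENNReal.ofReal (Real.exp t) := by
  rw [← lintegral_indicator_one hB]
  refine lintegral_le_of_exp_birkhoffSum_mul_le hstat hg n _ _
    (measurable_one.indicator hB) fun x => ?_
  by_cases hx : x ∈ B
  · simpa [hx] using ENNReal.ofReal_le_ofReal (Real.exp_le_exp.2 (h x hx))
  · simp [hx]

/-- The mass of the cylinder over `U` with base `B 0 × ⋯ × B (n - 1)`. -/
theorem le_lintegral_of_le_exp_birkhoffSum_mul [SFinite m] (hstat : IsStationary m g μ)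
    (hg : Continuous g) {U : Set (ℕ → M)} (n : ℕ) :
    ∀ (B : ℕ → Set M) (ψ : (ℕ → M) → ℝ≥0∞) (K : ℝ≥0∞), (∀ i, MeasurableSet (B i)) → Measurable ψ →
      (∀ x, (∀ i < n, x i ∈ B i) → shift^[n] x ∈ U →
        K ≤ ENNReal.ofReal (Real.exp (birkhoffSum shift g n x)) * ψ x) →
      K * (∏ i ∈ Finset.range n, m (B i)) * μ U ≤ ∫⁻ x, ψ x ∂μ := by
  induction n with
  | zero =>
    intro B ψ K _ hψ h
    calc K * (∏ i ∈ Finset.range 0, m (B i)) * μ U = ∫⁻ _ in U, K ∂μ := by simp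
      _ ≤ ∫⁻ x in U, ψ x ∂μ := setLIntegral_mono hψ fun x hx => by
          simpa using h x (by simp) hx
      _ ≤ ∫⁻ x, ψ x ∂μ := setLIntegral_le_lintegral _ _
  | succ n ih =>
    intro B ψ K hB hψ h
    rw [hstat ψ hψ, Finset.prod_range_succ', mul_comm (∏ i ∈ Finset.range n, m (B (i + 1))),
      ← mul_assoc]
    refine ih (fun i => B (i + 1)) _ (K * m (B 0)) (fun i => hB _) (measurable_transfer hg hψ)
      fun x hx hxU => ?_
    rw [exp_birkhoffSum_mul_transfer]
    calc K * m (B 0) = ∫⁻ _ in B 0, K ∂m := by simp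
      _ ≤ ∫⁻ a in B 0, ENNReal.ofReal (Real.exp (birkhoffSum shift g (n + 1) (prepend a x))) *
            ψ (prepend a x) ∂m := by
          have hpre := (continuous_prepend_left x).measurable
          have hb : Measurable fun z => birkhoffSum shift g (n + 1) z := by
            unfold birkhoffSum
            exact (continuous_finsetSum _ fun i _ =>
              hg.comp (continuous_shift.iterate i)).measurable
          refine setLIntegral_mono
            (((hb.exp.comp hpre).ennreal_ofReal).mul (hψ.comp hpre)) fun a ha => ?_
          refine h _ (fun i hi => ?_) hxU
          cases i with
          | zero => exact ha
          | succ i => exact hx i (by omega)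
      _ ≤ _ := setLIntegral_le_lintegral _ _

theorem le_measure_of_cylinder [SFinite m] (hstat : IsStationary m g μ)
    (hg : Continuous g) {U A : Set (ℕ → M)} (hA : MeasurableSet A) (n : ℕ) {B : ℕ → Set M}
    (hB : ∀ i, MeasurableSet (B i)) {t : ℝ}
    (h : ∀ x, (∀ i < n, x i ∈ B i) → shift^[n] x ∈ U → x ∈ A ∧ t ≤ birkhoffSum shift g n x) :
    ENNReal.ofReal (Real.exp t) * (∏ i ∈ Finset.range n, m (B i)) * μ U ≤ μ A := by
  rw [← lintegral_indicator_one hA]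
  refine le_lintegral_of_le_exp_birkhoffSum_mul hstat hg n B _ _ hB
    (measurable_one.indicator hA) fun x hx hxU => ?_
  obtain ⟨h1, h2⟩ := h x hx hxU
  simpa [h1] using ENNReal.ofReal_le_ofReal (Real.exp_le_exp.2 h2)

end Transfer

/-- Eigenfunctions inherit the regularity of the potential. -/
theorem abs_log_eigenfunction_sub_le [IsProbabilityMeasure m] {u : (ℕ → M) → ℝ} {s C α : ℝ}
    (hα : 0 < α) (hφ : ∀ x y, |φ x - φ y| ≤ C * seqDist x y ^ α) (hφc : Continuous φ)
    (hu : Continuous u)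
    (heig : ∀ x, ∫ a, Real.exp (φ (prepend a x) + u (prepend a x)) ∂m = Real.exp (u x + s))
    (x y : ℕ → M) : |u x - u y| ≤ C * distortionConst α * seqDist x y ^ α := by
  have hint : ∀ z : ℕ → M, Integrable (fun a => Real.exp (φ (prepend a z) + u (prepend a z))) m :=
    fun z => integrable_of_continuous ((hφc.add hu).comp (continuous_prepend_left z)).rexp m
  have step : ∀ (x y : ℕ → M) (t : ℝ), (∀ a, φ (prepend a x) + u (prepend a x) ≤
      φ (prepend a y) + u (prepend a y) + t) → u x ≤ u y + t := by
    intro x y t h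
    have h1 : Real.exp (u x + s) ≤ Real.exp (u y + t + s) := by
      rw [show u y + t + s = (u y + s) + t by ring, Real.exp_add (u y + s), ← heig, ← heig,
        ← integral_mul_const]
      refine integral_mono (hint x) ((hint y).mul_const _) fun a => ?_
      simp only
      rw [← Real.exp_add]
      exact Real.exp_le_exp.2 (h a)
    linarith [Real.exp_le_exp.1 h1]
  -- A priori `u` is only uniformly continuous. Prepending symbols halves the distance until it
  -- falls below `δ`, where `u` oscillates by less than `ε`; the Hölder errors met on the way add up
  -- geometrically, and `ε` is finally sent to zero.
  have main : ∀ ε > 0, ∀ x y, u x ≤ u y + (ε + C * distortionConst α * seqDist x y ^ α) := by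
    intro ε hε
    obtain ⟨δ, hδ, hmod⟩ := exists_seqDist_lt_imp_abs_sub_lt hu hε
    have scale : ∀ (n : ℕ) (x y : ℕ → M), seqDist x y < 2 ^ n * δ →
        0 ≤ C * distortionConst α * seqDist x y ^ α →
        u x ≤ u y + (ε + C * distortionConst α * seqDist x y ^ α) := by
      intro n
      induction n with
      | zero =>
        intro x y h h0
        have := hmod x y (by simpa using h)
        linarith [(abs_lt.1 this).2]
      | succ n ih =>
        intro x y h _
        refine step x y _ fun a => ?_
        have h0 := hφ (prepend a x) (prepend a y)
        have hC : 0 ≤ C * seqDist (prepend a x) (prepend a y) ^ α := (abs_nonneg _).trans h0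
        have h1 := ih (prepend a x) (prepend a y)
          (by rw [seqDist_prepend]; rw [pow_succ] at h; linarith)
          (by rw [mul_right_comm]; exact mul_nonneg hC (distortionConst_pos hα).le)
        have h2 : C * seqDist (prepend a x) (prepend a y) ^ α +
            C * distortionConst α * seqDist (prepend a x) (prepend a y) ^ α =
            C * distortionConst α * seqDist x y ^ α := by
          rw [← two_rpow_mul_half_rpow (seqDist_nonneg x y), ← seqDist_prepend a]
          calc _ = C * (1 + distortionConst α) * seqDist (prepend a x) (prepend a y) ^ α := by ring
            _ = _ := by rw [distortionConst_spec hα]; ring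
        linarith [(abs_le.1 h0).2]
    intro x y
    obtain ⟨n, hn⟩ := pow_unbounded_of_one_lt (seqDist x y / δ) one_lt_two
    refine scale n x y ((div_lt_iff₀ hδ).1 hn) ?_
    rw [mul_right_comm]
    exact mul_nonneg ((abs_nonneg _).trans (hφ x y)) (distortionConst_pos hα).le
  have main' : ∀ x y, u x ≤ u y + C * distortionConst α * seqDist x y ^ α := fun x y =>
    le_of_forall_pos_le_add fun ε hε => by linarith [main ε hε x y]
  rw [abs_le]
  have h1 := main' y x
  rw [seqDist_comm] at h1
  constructor <;> linarith [main' x y]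

end Gibbs

/-! ### Defects of subactions, weak limits and calibrated backward orbits. -/

/-- The defect `β + V ∘ σ - V - f` of a subaction `V`. -/
def defect {M : Type*} (β : ℝ) (f V : (ℕ → M) → ℝ) (x : ℕ → M) : ℝ :=
  β + V (shift x) - V x - f x

theorem Rplus_eq_defect {M : Type*} [MeasurableSpace M] (f V : (ℕ → M) → ℝ) :
    Rplus f V = defect (maxMean f) f V := rfl

theorem birkhoffSum_defect {M : Type*} (β : ℝ) (f V : (ℕ → M) → ℝ) (n : ℕ) (x : ℕ → M) :
    birkhoffSum shift (defect β f V) n x =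
      n * β + V (shift^[n] x) - V x - birkhoffSum shift f n x := by
  induction n generalizing x with
  | zero => simp
  | succ n ih =>
    rw [birkhoffSum_succ', birkhoffSum_succ', ih, Function.iterate_succ_apply, defect]
    push_cast
    ring

/-- Compactness of the space of probabilities, with the portmanteau inequality on open sets. Being a
probability is only asked eventually because `μ_c` is controlled only for `c > 0`. -/
theorem exists_weak_limit {Ω : Type*} [TopologicalSpace Ω] [CompactSpace Ω] [T2Space Ω]
    [HasOuterApproxClosed Ω] [MeasurableSpace Ω] [BorelSpace Ω] {ι : Type*} (𝒰 : Ultrafilter ι)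
    (P : ι → Measure Ω) (hP : ∀ᶠ i in (𝒰 : Filter ι), IsProbabilityMeasure (P i)) :
    ∃ Q : Measure Ω, IsProbabilityMeasure Q ∧
      (∀ w : Ω → ℝ, Continuous w →
        Tendsto (fun i => ∫ x, w x ∂(P i)) 𝒰 (𝓝 (∫ x, w x ∂Q))) ∧
      ∀ U : Set Ω, IsOpen U → ∀ t : ℝ≥0∞, (∀ᶠ i in (𝒰 : Filter ι), P i U ≤ t) → Q U ≤ t := by
  classical
  obtain ⟨i₀, hi₀⟩ := hP.exists
  let P' : ι → ProbabilityMeasure Ω := fun i =>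
    if h : IsProbabilityMeasure (P i) then ⟨P i, h⟩ else ⟨P i₀, hi₀⟩
  have hP' : ∀ᶠ i in (𝒰 : Filter ι), (P' i : Measure Ω) = P i := by
    filter_upwards [hP] with i hi
    simp [P', hi]
  have hlim : Tendsto P' 𝒰 (𝓝 (𝒰.map P').lim) := (𝒰.map P').le_nhds_lim
  refine ⟨((𝒰.map P').lim : ProbabilityMeasure Ω), inferInstance, fun w hw => ?_,
    fun U hU t ht => ?_⟩
  · refine ((ProbabilityMeasure.tendsto_iff_forall_integral_tendsto.1 hlim
      (BoundedContinuousFunction.mkOfCompact ⟨w, hw⟩)).congr' ?_)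
    filter_upwards [hP'] with i hi
    rw [hi]
    rfl
  · refine (ProbabilityMeasure.le_liminf_measure_open_of_tendsto hlim hU).trans ?_
    refine (liminf_le_liminf (v := fun _ => t) ?_).trans (liminf_const t).le
    filter_upwards [hP', ht] with i hi hti
    rwa [hi]

theorem continuous_defect {M : Type*} [TopologicalSpace M] (β : ℝ) {f V : (ℕ → M) → ℝ}
    (hf : Continuous f) (hV : Continuous V) : Continuous (defect β f V) :=
  ((continuous_const.add (hV.comp continuous_shift)).sub hV).sub hf

theorem exists_backward_orbit {M : Type*} {β : ℝ} {f V : (ℕ → M) → ℝ}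
    (hcal : ∀ y, ∃ x, shift x = y ∧ defect β f V x = 0) 
    (y₀ : ℕ → M) :
    ∃ y : ℕ → ℕ → M, y 0 = y₀ ∧ (∀ i, shift (y (i + 1)) = y i) ∧
      ∀ i, defect β f V (y (i + 1)) = 0 := by
  choose b hb hb0 using hcal
  exact ⟨fun i => Nat.rec y₀ (fun _ => b) i, rfl, fun i => hb _, fun i => hb0 _⟩

/-! ### Empirical measures and rigidity of calibrated subactions. -/

section Invariant

variable {M : Type*} [MetricSpace M] [CompactSpace M] [MeasurableSpace M] [BorelSpace M]

theorem mem_invariantProbabilities {Q : Measure (ℕ → M)} [IsProbabilityMeasure Q]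
    (h : ∀ w : (ℕ → M) → ℝ, Continuous w → ∫ x, w (shift x) ∂Q = ∫ x, w x ∂Q) :
    Q ∈ invariantProbabilities M := by
  have hmeas : Measurable (shift : (ℕ → M) → ℕ → M) := continuous_shift.measurable
  have := Measure.isProbabilityMeasure_map (μ := Q) hmeas.aemeasurable
  refine ⟨inferInstance, hmeas, measure_ext_of_continuous fun w hw => ?_⟩
  rw [integral_map hmeas.aemeasurable hw.aestronglyMeasurable, h w hw]

theorem integral_defect {β : ℝ} {f V : (ℕ → M) → ℝ} (hf : Continuous f) (hV : Continuous V)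
    {Q : Measure (ℕ → M)} (hQ : Q ∈ invariantProbabilities M) :
    ∫ x, defect β f V x ∂Q = β - ∫ x, f x ∂Q := by
  obtain ⟨hp, hinv⟩ := hQ
  have h1 : ∫ x, V (shift x) ∂Q = ∫ x, V x ∂Q := by
    conv_rhs => rw [← hinv.map_eq]
    rw [integral_map hinv.measurable.aemeasurable hV.aestronglyMeasurable]
  have i1 : Integrable (fun x => V (shift x)) Q :=
    integrable_of_continuous (hV.comp continuous_shift) Q
  have i2 := integrable_of_continuous hV Q
  have i3 := integrable_of_continuous hf Q
  have i0 : Integrable (fun _ : ℕ → M => β) Q := integrable_const β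
  simp only [defect]
  rw [integral_sub (f := fun x => β + V (shift x) - V x) ((i0.add i1).sub i2) i3,
    integral_sub (f := fun x => β + V (shift x)) (i0.add i1) i2, integral_add i0 i1, h1]
  simp

/-- Empirical measures along a forward or backward orbit accumulate at an invariant probability;
a nonnegative observable with bounded sums along the orbit has integral zero. -/
theorem exists_empirical_limit (y : ℕ → ℕ → M)
    (hy : (∀ i, shift (y i) = y (i + 1)) ∨ ∀ i, shift (y (i + 1)) = y i)
    {r : (ℕ → M) → ℝ} (hr : Continuous r) {B : ℝ}
    (hB : ∀ n, |∑ i ∈ Finset.range n, r (y i)| ≤ B) :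
    ∃ Q ∈ invariantProbabilities M, ∫ x, r x ∂Q = 0 ∧
      ∀ U : Set (ℕ → M), IsOpen U → (∀ i, y i ∉ U) → Q U = 0 := by
  let P : ℕ → Measure (ℕ → M) := fun n =>
    ((n + 1 : ℕ) : ℝ≥0∞)⁻¹ • ∑ i ∈ Finset.range (n + 1), Measure.dirac (y i)
  have hP : ∀ n, IsProbabilityMeasure (P n) := fun n => ⟨by
    simp only [P, Measure.smul_apply, Measure.finsetSum_apply, measure_univ, Finset.sum_const,
      Finset.card_range, nsmul_eq_mul, mul_one, smul_eq_mul]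
    exact ENNReal.inv_mul_cancel (by simp) (ENNReal.natCast_ne_top _)⟩
  have hPi : ∀ (w : (ℕ → M) → ℝ), Continuous w → ∀ n, ∫ x, w x ∂(P n) =
      ((n + 1 : ℕ) : ℝ)⁻¹ * ∑ i ∈ Finset.range (n + 1), w (y i) := by
    intro w hw n
    simp only [P]
    rw [integral_smul_measure, integral_finsetSum_measure
      fun i _ => integrable_of_continuous hw _, ENNReal.toReal_inv, ENNReal.toReal_natCast]
    simp
  obtain ⟨Q, hQ, hlim, hopen⟩ := exists_weak_limit (hyperfilter ℕ) P (Eventually.of_forall hP)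
  have hle : ((hyperfilter ℕ : Ultrafilter ℕ) : Filter ℕ) ≤ atTop := Nat.hyperfilter_le_atTop
  have hzero : ∀ (a : ℕ → ℝ) (b : ℝ), (∀ n, |a n| ≤ b) →
      Tendsto (fun n : ℕ => ((n + 1 : ℕ) : ℝ)⁻¹ * a n) (hyperfilter ℕ) (𝓝 0) := by
    intro a b hab
    refine Tendsto.mono_left ?_ hle
    have h1 : Tendsto (fun n : ℕ => ((n + 1 : ℕ) : ℝ)⁻¹ * b) atTop (𝓝 0) := by
      have := (tendsto_inv_atTop_nhds_zero_nat (𝕜 := ℝ)).comp (tendsto_add_atTop_nat 1)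
      simpa using this.mul_const b
    refine squeeze_zero_norm (fun n => ?_) h1
    rw [norm_mul, Real.norm_eq_abs (a n), Real.norm_of_nonneg (by positivity)]
    exact mul_le_mul_of_nonneg_left (hab n) (by positivity)
  refine ⟨Q, mem_invariantProbabilities fun w hw => ?_, ?_, fun U hU h => ?_⟩
  · obtain ⟨C, hC⟩ : ∃ C, ∀ x, |w x| ≤ C := by
      obtain ⟨C, hC⟩ := isCompact_univ.exists_bound_of_continuousOn hw.continuousOn
      exact ⟨C, fun x => hC x (Set.mem_univ x)⟩
    have h1 := (hlim _ (hw.comp continuous_shift)).sub (hlim w hw)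
    have h2 := hzero (fun n => ∑ i ∈ Finset.range (n + 1), (w (shift (y i)) - w (y i))) (C + C) ?_
    · refine sub_eq_zero.1 (tendsto_nhds_unique h1 (h2.congr fun n => ?_))
      rw [hPi _ (hw.comp continuous_shift), hPi w hw, ← mul_sub, ← Finset.sum_sub_distrib]
      rfl
    · intro n
      -- The sum telescopes in either direction of time, leaving two boundary terms.
      obtain ⟨a, b, hab⟩ : ∃ a b, ∑ i ∈ Finset.range (n + 1), (w (shift (y i)) - w (y i)) =
          w a - w b := by
        rcases hy with hy | hy
        · refine ⟨y (n + 1), y 0, ?_⟩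
          simp only [hy]
          exact Finset.sum_range_sub (fun i => w (y i)) (n + 1)
        · refine ⟨shift (y 0), y n, ?_⟩
          rw [Finset.sum_range_succ']
          simp only [hy]
          rw [Finset.sum_range_sub' (fun i => w (y i)) n]
          ring
      rw [hab]
      exact (abs_sub _ _).trans (add_le_add (hC a) (hC b))
  · refine tendsto_nhds_unique (hlim r hr) ?_
    exact (hzero (fun n => ∑ i ∈ Finset.range (n + 1), r (y i)) B fun n => hB _).congr
      fun n => (hPi r hr n).symm
  · refine le_antisymm (hopen U hU 0 (Eventually.of_forall fun n => ?_)) bot_le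
    simp only [P, Measure.smul_apply, Measure.finsetSum_apply, smul_eq_mul]
    simp [Measure.dirac_apply' _ hU.measurableSet, h]

variable {β : ℝ} {f V : (ℕ → M) → ℝ}

/-- An orbit with bounded sums of the defect recurs to every open set charged by the unique
maximizing measure. -/
theorem exists_orbit_mem (hf : Continuous f) (hV : Continuous V) {μ : Measure (ℕ → M)}
    (huniq : ∀ Q ∈ invariantProbabilities M, ∫ x, f x ∂Q = β → Q = μ)
    {U : Set (ℕ → M)} (hU : IsOpen U) (hμU : μ U ≠ 0) (y : ℕ → ℕ → M)
    (hy : (∀ i, shift (y i) = y (i + 1)) ∨ ∀ i, shift (y (i + 1)) = y i) {B : ℝ}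
    (hB : ∀ n, |∑ i ∈ Finset.range n, defect β f V (y i)| ≤ B) : ∃ i, y i ∈ U := by
  by_contra! h
  obtain ⟨Q, hQ, hr, hopen⟩ := exists_empirical_limit y hy (continuous_defect β hf hV) hB
  rw [integral_defect hf hV hQ] at hr
  rw [huniq Q hQ (by linarith)] at hopen
  exact hμU (hopen U hU h)

/-- The integral of the defect against an invariant probability is `β - ∫ f`. Nonnegativity gives
one inequality; empirical limits along a backward orbit of zero defect attain equality. -/
theorem maxMean_eq [Nonempty M] (hf : Continuous f) (hV : Continuous V)
    (hsub : ∀ x, 0 ≤ defect β f V x)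
    (hcal : ∀ y, ∃ x, shift x = y ∧ defect β f V x = 0) : maxMean f = β := by
  refine IsGreatest.csSup_eq ⟨?_, ?_⟩
  · obtain ⟨y, -, hy, hy0⟩ := exists_backward_orbit hcal (Classical.arbitrary (ℕ → M))
    obtain ⟨Q, hQ, hr, -⟩ := exists_empirical_limit (fun i => y (i + 1))
      (Or.inr fun i => hy (i + 1)) (continuous_defect β hf hV) (B := 0) (fun n => by simp [hy0])
    rw [integral_defect hf hV hQ] at hr
    exact ⟨Q, hQ, by simp only; linarith⟩
  · rintro _ ⟨Q, hQ, rfl⟩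
    have h := integral_nonneg (μ := Q) (f := defect β f V) hsub
    rw [integral_defect hf hV hQ] at h
    simp only
    linarith

theorem exists_mem_nhds_pos {Ω : Type*} [TopologicalSpace Ω] [SecondCountableTopology Ω]
    [MeasurableSpace Ω] {μ : Measure Ω} (hμ : μ ≠ 0) : ∃ p, ∀ U ∈ 𝓝 p, μ U ≠ 0 := by
  obtain ⟨p, -, hp⟩ := exists_mem_forall_mem_nhdsWithin_pos_measure (μ := μ) (s := Set.univ)
    (by simpa using hμ)
  exact ⟨p, fun U hU => (hp U (by simpa using hU)).ne'⟩

/-- Along a backward orbit calibrated for `V` the difference `V - V'` does not decrease, and the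
orbit visits every neighbourhood of `p`. -/
theorem sub_le_sub_of_mem_support {V' : (ℕ → M) → ℝ} (hf : Continuous f) (hV : Continuous V)
    (hV' : Continuous V') (hcal : ∀ y, ∃ x, shift x = y ∧ defect β f V x = 0)
    (hsub' : ∀ x, 0 ≤ defect β f V' x) {μ : Measure (ℕ → M)}
    (huniq : ∀ Q ∈ invariantProbabilities M, ∫ x, f x ∂Q = β → Q = μ)
    {p : ℕ → M} (hp : ∀ U ∈ 𝓝 p, μ U ≠ 0) (x : ℕ → M) : V x - V' x ≤ V p - V' p := by
  refine le_of_forall_pos_lt_add fun ε hε => ?_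
  obtain ⟨y, rfl, hy, hy0⟩ := exists_backward_orbit hcal x
  have hmono : ∀ i, V (y 0) - V' (y 0) ≤ V (y i) - V' (y i) := by
    intro i
    induction i with
    | zero => exact le_rfl
    | succ i ih =>
      have h1 := hy0 i
      have h2 := hsub' (y (i + 1))
      rw [defect, hy i] at h1 h2
      linarith
  have hUo : IsOpen {z | V z - V' z < V p - V' p + ε} :=
    isOpen_lt (hV.sub hV') continuous_const
  obtain ⟨i, hi⟩ := exists_orbit_mem hf hV huniq hUo
    (hp _ (hUo.mem_nhds (by simpa using hε))) (fun i => y (i + 1))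
    (Or.inr fun i => hy (i + 1)) (B := 0) (fun n => by simp [hy0])
  exact (hmono (i + 1)).trans_lt hi

/-- The previous comparison, applied both ways at the same point `p`, forces `V - V'` to be
constant. -/
theorem calibrated_sub_const {V' : (ℕ → M) → ℝ} (hf : Continuous f) (hV : Continuous V)
    (hV' : Continuous V') (hcal : ∀ y, ∃ x, shift x = y ∧ defect β f V x = 0)
    (hsub : ∀ x, 0 ≤ defect β f V x)
    (hcal' : ∀ y, ∃ x, shift x = y ∧ defect β f V' x = 0)
    (hsub' : ∀ x, 0 ≤ defect β f V' x) {μ : Measure (ℕ → M)} (hμ : μ ≠ 0)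
    (huniq : ∀ Q ∈ invariantProbabilities M, ∫ x, f x ∂Q = β → Q = μ) :
    defect β f V' = defect β f V := by
  obtain ⟨p, hp⟩ := exists_mem_nhds_pos hμ
  have h1 := sub_le_sub_of_mem_support hf hV hV' hcal hsub' huniq hp
  have h2 := sub_le_sub_of_mem_support hf hV' hV hcal' hsub huniq hp
  funext x
  unfold defect
  linarith [h1 x, h2 x, h1 (shift x), h2 (shift x)]

end Invariant

/-! ### The zero-temperature limit of the normalized potentials. -/

theorem exists_tendsto_of_abs_le {ι : Type*} (𝒰 : Ultrafilter ι) {v : ι → ℝ} {B : ℝ}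
    (h : ∀ᶠ i in (𝒰 : Filter ι), |v i| ≤ B) : ∃ l, Tendsto v 𝒰 (𝓝 l) := by
  obtain ⟨l, -, hl⟩ := (isCompact_Icc (a := -B) (b := B)).ultrafilter_le_nhds' (𝒰.map v)
    (h.mono fun i hi => abs_le.1 hi)
  exact ⟨l, hl⟩

section Compact

variable {M : Type*} [MetricSpace M] [CompactSpace M]

/-- Pointwise convergence of a family with a common modulus of continuity is uniform. -/
theorem eventually_forall_abs_sub_le {ι : Type*} {l : Filter ι} {v : ι → (ℕ → M) → ℝ}
    {w : (ℕ → M) → ℝ} {C α : ℝ} (hα : 0 < α)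
    (hv : ∀ᶠ i in l, ∀ x y, |v i x - v i y| ≤ C * seqDist x y ^ α)
    (hw : ∀ x y, |w x - w y| ≤ C * seqDist x y ^ α)
    (hlim : ∀ x, Tendsto (fun i => v i x) l (𝓝 (w x))) {η : ℝ} (hη : 0 < η) :
    ∀ᶠ i in l, ∀ x, |v i x - w x| ≤ η := by
  have hnhds : ∀ p : ℕ → M, {x | C * seqDist x p ^ α < η / 3} ∈ 𝓝 p := by
    intro p
    have hc : Continuous fun x => C * seqDist x p ^ α :=
      continuous_const.mul ((continuous_seqDist.comp
        (Continuous.prodMk_left p)).rpow_const fun _ => Or.inr hα.le)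
    refine (isOpen_lt hc continuous_const).mem_nhds ?_
    simp only [Set.mem_ofPred_eq, seqDist_self, Real.zero_rpow hα.ne', mul_zero]
    positivity
  obtain ⟨t, -, ht⟩ := isCompact_univ.elim_nhds_subcover _ fun p _ => hnhds p
  have hfin : ∀ᶠ i in l, ∀ p ∈ t, |v i p - w p| < η / 3 := by
    rw [eventually_all_finset]
    intro p _
    exact (Metric.tendsto_nhds.1 (hlim p)) (η / 3) (by positivity)
  filter_upwards [hv, hfin] with i hi hti x
  obtain ⟨p, hp, hxp⟩ := Set.mem_iUnion₂.1 (ht (Set.mem_univ x))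
  have h0 : C * seqDist x p ^ α < η / 3 := hxp
  have h1 := abs_le.1 (hi x p)
  have h2 := abs_le.1 (hw x p)
  have h3 := abs_lt.1 (hti p hp)
  rw [abs_le]
  constructor <;> linarith

end Compact

theorem integral_exp_normalized {M : Type*} [MeasurableSpace M] {m : Measure M}
    {φ u : (ℕ → M) → ℝ} {s : ℝ}
    (heig : ∀ x, ∫ a, Real.exp (φ (prepend a x) + u (prepend a x)) ∂m = Real.exp (u x + s))
    (x : ℕ → M) : ∫ a, Real.exp (normalized φ u s (prepend a x)) ∂m = 1 := by
  have h : ∀ a, Real.exp (normalized φ u s (prepend a x)) =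
      Real.exp (φ (prepend a x) + u (prepend a x)) * Real.exp (-(u x + s)) := by
    intro a
    rw [← Real.exp_add, normalized, shift_prepend]
    congr 1
    ring
  simp_rw [h]
  rw [integral_mul_const, heig, ← Real.exp_add, add_neg_cancel, Real.exp_zero]

section Normalized

variable {M : Type*} [MetricSpace M] [CompactSpace M] [MeasurableSpace M] [BorelSpace M]
  {m : Measure M} [IsProbabilityMeasure m] {g : (ℕ → M) → ℝ}

/-- A probability density cannot stay below one. With `exp_mul_measureReal_le_one`, which forbids
large values on sets of positive mass, this controls `s / c` and identifies the limits as calibrated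
subactions. -/
theorem nonneg_of_forall_le (hg : Continuous g) {x : ℕ → M}
    (hint : ∫ a, Real.exp (g (prepend a x)) ∂m = 1) {t : ℝ} (h : ∀ a, g (prepend a x) ≤ t) :
    0 ≤ t := by
  rw [← Real.one_le_exp_iff, ← hint]
  calc _ ≤ ∫ _, Real.exp t ∂m := integral_mono
        (integrable_of_continuous (hg.comp (continuous_prepend_left x)).rexp m)
        (integrable_const _) fun a => Real.exp_le_exp.2 (h a)
    _ = Real.exp t := by simp

theorem exp_mul_measureReal_le_one (hg : Continuous g) {x : ℕ → M}
    (hint : ∫ a, Real.exp (g (prepend a x)) ∂m = 1) {O : Set M} (hO : MeasurableSet O) {t : ℝ}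
    (h : ∀ a ∈ O, t ≤ g (prepend a x)) : Real.exp t * m.real O ≤ 1 := by
  have hi := integrable_of_continuous (hg.comp (continuous_prepend_left x)).rexp m
  calc Real.exp t * m.real O = ∫ _ in O, Real.exp t ∂m := by simp [mul_comm]
    _ ≤ ∫ a in O, Real.exp (g (prepend a x)) ∂m :=
        setIntegral_mono_on (integrable_const _).integrableOn hi.integrableOn hO
          fun a ha => Real.exp_le_exp.2 (h a ha)
    _ ≤ ∫ a, Real.exp (g (prepend a x)) ∂m :=
        setIntegral_le_integral hi (Eventually.of_forall fun a => (Real.exp_pos _).le)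
    _ = 1 := hint

end Normalized

section Limit

variable {M : Type*} [MetricSpace M] [CompactSpace M] [Nonempty M] [MeasurableSpace M]
  [BorelSpace M] {m : Measure M} [IsProbabilityMeasure m] [m.IsOpenPosMeasure]
  {f : (ℕ → M) → ℝ} {u : ℝ → (ℕ → M) → ℝ} {s : ℝ → ℝ}

/-- Every ultrafilter limit of the normalized potentials is `-defect` of a calibrated
subaction. -/
theorem exists_calibrated_limit (hf : IsHolder f) (hu : ∀ c > 0, Continuous (u c))
    (heig : ∀ c > 0, ∀ x, ∫ a, Real.exp (c * f (prepend a x) + u c (prepend a x)) ∂m =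
      Real.exp (u c x + s c))
    (𝒰 : Ultrafilter ℝ) (h𝒰 : (𝒰 : Filter ℝ) ≤ atTop) :
    ∃ (β : ℝ) (V : (ℕ → M) → ℝ), Continuous V ∧ (∀ x, 0 ≤ defect β f V x) ∧
      (∀ y, ∃ x, shift x = y ∧ defect β f V x = 0) ∧
      ∀ η > 0, ∀ᶠ c in (𝒰 : Filter ℝ), ∀ x,
        |c⁻¹ * normalized (fun x => c * f x) (u c) (s c) x + defect β f V x| ≤ η := by
  have hfc := continuous_of_isHolder hf
  obtain ⟨C, α, hα, hα1, hC⟩ := hf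
  have hpos : ∀ᶠ c in (𝒰 : Filter ℝ), 0 < c := h𝒰 (eventually_gt_atTop 0)
  set x₀ : ℕ → M := Classical.arbitrary _
  -- Subtracting the value at `x₀` turns the common Hölder modulus into a uniform bound.
  set v : ℝ → (ℕ → M) → ℝ := fun c x => c⁻¹ * (u c x - u c x₀) with hv
  set K := C * distortionConst α with hK
  have hmod : ∀ c > 0, ∀ x y, |v c x - v c y| ≤ K * seqDist x y ^ α := by
    intro c hc x y
    have h := abs_log_eigenfunction_sub_le (m := m) (φ := fun x => c * f x) (u := u c) (s := s c)
      (C := c * C) hα (fun x y => by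
        rw [← mul_sub, abs_mul, abs_of_pos hc, mul_assoc]
        exact mul_le_mul_of_nonneg_left (hC x y) hc.le)
      (continuous_const.mul hfc) (hu c hc) (heig c hc) x y
    rw [show v c x - v c y = c⁻¹ * (u c x - u c y) by simp only [hv]; ring, abs_mul,
      abs_of_pos (inv_pos.2 hc), inv_mul_le_iff₀ hc, hK]
    linarith
  obtain ⟨B, hB⟩ : ∃ B, ∀ c > 0, ∀ x, |v c x| ≤ B := by
    refine ⟨|K| * Metric.diam (Set.univ : Set M) ^ α, fun c hc x => ?_⟩
    have h := hmod c hc x x₀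
    rw [show v c x₀ = 0 by simp [hv], sub_zero] at h
    refine h.trans (mul_le_mul (le_abs_self K) ?_ (Real.rpow_nonneg (seqDist_nonneg _ _) _)
      (abs_nonneg K))
    exact Real.rpow_le_rpow (seqDist_nonneg _ _) (seqDist_le_diam _ _) hα.le
  obtain ⟨F, hF⟩ : ∃ F, ∀ x, |f x| ≤ F := by
    obtain ⟨F, hF⟩ := isCompact_univ.exists_bound_of_continuousOn hfc.continuousOn
    exact ⟨F, fun x => hF x (Set.mem_univ x)⟩
  have hq : ∀ c > 0, ∀ x, normalized (fun x => c * f x) (u c) (s c) x =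
      c * (f x + v c x - v c (shift x) - c⁻¹ * s c) := by
    intro c hc x
    simp only [hv, normalized]
    field_simp
    ring
  have hg : ∀ c > 0, Continuous (normalized (fun x => c * f x) (u c) (s c)) := fun c hc =>
    continuous_normalized (continuous_const.mul hfc) (hu c hc) _
  have hint : ∀ c > 0, ∀ x, ∫ a, Real.exp
      (normalized (fun x => c * f x) (u c) (s c) (prepend a x)) ∂m = 1 := fun c hc =>
    integral_exp_normalized (heig c hc)
  have hs : ∀ c > 0, |c⁻¹ * s c| ≤ F + B + B := by
    intro c hc
    rw [abs_le]
    constructor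
    · have h := exp_mul_measureReal_le_one (hg c hc) (hint c hc x₀) MeasurableSet.univ
        (t := c * (-(F + B + B) - c⁻¹ * s c)) fun a _ => by
          rw [hq c hc]
          refine mul_le_mul_of_nonneg_left ?_ hc.le
          have h1 := abs_le.1 (hF (prepend a x₀))
          have h2 := abs_le.1 (hB c hc (prepend a x₀))
          have h3 := abs_le.1 (hB c hc (shift (prepend a x₀)))
          linarith
      rw [probReal_univ, mul_one, Real.exp_le_one_iff] at h
      have := nonpos_of_mul_nonpos_right h hc
      linarith
    · have h := nonneg_of_forall_le (hg c hc) (hint c hc x₀)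
        (t := c * (F + B + B - c⁻¹ * s c)) fun a => by
          rw [hq c hc]
          refine mul_le_mul_of_nonneg_left ?_ hc.le
          have h1 := abs_le.1 (hF (prepend a x₀))
          have h2 := abs_le.1 (hB c hc (prepend a x₀))
          have h3 := abs_le.1 (hB c hc (shift (prepend a x₀)))
          linarith
      have := nonneg_of_mul_nonneg_right h hc
      linarith
  obtain ⟨β, hβ⟩ := exists_tendsto_of_abs_le 𝒰 (v := fun c => c⁻¹ * s c)
    (hpos.mono fun c hc => hs c hc)
  choose V hVlim using fun x => exists_tendsto_of_abs_le 𝒰 (v := fun c => v c x)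
    (hpos.mono fun c hc => hB c hc x)
  have hVmod : ∀ x y, |V x - V y| ≤ K * seqDist x y ^ α := fun x y =>
    le_of_tendsto ((hVlim x).sub (hVlim y)).abs (hpos.mono fun c hc => hmod c hc x y)
  have hVc : Continuous V := continuous_of_isHolder ⟨K, α, hα, hα1, hVmod⟩
  have hdc := continuous_defect β hfc hVc
  have hunif : ∀ η > 0, ∀ᶠ c in (𝒰 : Filter ℝ), ∀ x,
      |c⁻¹ * normalized (fun x => c * f x) (u c) (s c) x + defect β f V x| ≤ η := by
    intro η hη
    have h1 := eventually_forall_abs_sub_le hα (hpos.mono fun c hc => hmod c hc) hVmod hVlim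
      (η := η / 3) (by positivity)
    have h2 := (Metric.tendsto_nhds.1 hβ) (η / 3) (by positivity)
    filter_upwards [hpos, h1, h2] with c hc hc1 hc2 x
    rw [hq c hc, inv_mul_cancel_left₀ hc.ne', defect]
    have h3 := abs_le.1 (hc1 x)
    have h4 := abs_le.1 (hc1 (shift x))
    have h5 := abs_lt.1 hc2
    rw [abs_le]
    constructor <;> linarith
  -- A negative defect would make the density at least `exp (c * η)` on an open set of positive
  -- `m`-mass, exceeding total mass one for large `c`.
  have hsub : ∀ x, 0 ≤ defect β f V x := by
    intro x
    by_contra! hneg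
    set η := -defect β f V x / 4 with hη
    have hηpos : 0 < η := by linarith
    set O : Set M := {a | defect β f V (prepend a (shift x)) < -(2 * η)} with hO
    have hOo : IsOpen O :=
      isOpen_lt (hdc.comp (continuous_prepend_left (shift x))) continuous_const
    have hmO : 0 < m.real O := by
      refine ENNReal.toReal_pos (hOo.measure_pos m ⟨x 0, ?_⟩).ne' (measure_ne_top _ _)
      show defect β f V (prepend (x 0) (shift x)) < _
      rw [prepend_shift]
      linarith
    have hbig : ∀ᶠ c in (𝒰 : Filter ℝ), 1 < Real.exp (c * η) * m.real O :=
      h𝒰 (((Real.tendsto_exp_atTop.comp (tendsto_id.atTop_mul_const hηpos)).atTop_mul_const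
        hmO).eventually_gt_atTop 1)
    obtain ⟨c, hc, hc1, hc2⟩ := (hpos.and (hbig.and (hunif η hηpos))).exists
    refine absurd (exp_mul_measureReal_le_one (hg c hc) (hint c hc (shift x)) hOo.measurableSet
      fun a ha => ?_) (not_le.2 hc1)
    have h1 := (abs_le.1 (hc2 (prepend a (shift x)))).1
    have h2 : defect β f V (prepend a (shift x)) < -(2 * η) := ha
    rw [← le_inv_mul_iff₀ hc]
    linarith
  refine ⟨β, V, hVc, hsub, fun y => ?_, hunif⟩
  -- If the least defect over the preimages of `y` were positive, the density would be at most `exp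
  -- (-c * η) < 1` on the whole fibre.
  obtain ⟨a, -, ha⟩ := isCompact_univ.exists_isMinOn Set.univ_nonempty
    (hdc.comp (continuous_prepend_left y)).continuousOn
  refine ⟨prepend a y, rfl, ?_⟩
  have hmin : ∀ b, defect β f V (prepend a y) ≤ defect β f V (prepend b y) :=
    fun b => ha (Set.mem_univ b)
  refine le_antisymm ?_ (hsub _)
  by_contra! hp
  set η := defect β f V (prepend a y) / 2 with hη
  have hηpos : 0 < η := by linarith
  obtain ⟨c, hc, hc2⟩ := (hpos.and (hunif η hηpos)).exists
  have h := nonneg_of_forall_le (hg c hc) (hint c hc y) (t := c * -η) fun b => by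
    have h1 := (abs_le.1 (hc2 (prepend b y))).2
    rw [← inv_mul_le_iff₀ hc]
    linarith [hmin b]
  have := nonneg_of_mul_nonneg_right h hc
  linarith

/-- The normalized potentials converge uniformly to `-R₊`. -/
theorem eventually_abs_normalized_add_Rplus_le (hf : IsHolder f)
    (hunique : ∃! μ : Measure (ℕ → M), IsMaximizing f μ) {V : (ℕ → M) → ℝ}
    (hV : IsCalibratedSubaction f V) (hu : ∀ c > 0, Continuous (u c))
    (heig : ∀ c > 0, ∀ x, ∫ a, Real.exp (c * f (prepend a x) + u c (prepend a x)) ∂m =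
      Real.exp (u c x + s c)) {η : ℝ} (hη : 0 < η) :
    ∀ᶠ c in atTop, ∀ x,
      |c⁻¹ * normalized (fun x => c * f x) (u c) (s c) x + Rplus f V x| ≤ η := by
  -- The limiting subaction `V'` may depend on the ultrafilter, but its defect does not.
  refine mem_iff_ultrafilter.2 fun 𝒰 h𝒰 => ?_
  obtain ⟨β, V', hV', hsub', hcal', hunif⟩ := exists_calibrated_limit hf hu heig 𝒰 h𝒰
  have hfc := continuous_of_isHolder hf
  have hβ := maxMean_eq hfc hV' hsub' hcal'
  subst hβ
  obtain ⟨μ, hμ, huniq⟩ := hunique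
  have hcal : ∀ y, ∃ x, shift x = y ∧ defect (maxMean f) f V x = 0 := fun y => by
    obtain ⟨x, hx, hxy⟩ := (hV.2 y).1
    refine ⟨x, hx, ?_⟩
    rw [defect, show shift x = y from hx]
    simp only at hxy
    linarith
  have := hμ.1.1
  rw [Rplus_eq_defect, ← calibrated_sub_const hfc hV.1 hV' hcal (Rplus_nonneg hV) hcal' hsub'
    (IsProbabilityMeasure.ne_zero μ) fun Q hQ hQf => huniq Q ⟨hQ, hQf⟩]
  exact hunif η hη

end Limit

/-! ### The rate as a supremum of Birkhoff sums. -/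

section Rate

variable {M : Type*} [MeasurableSpace M] {f V : (ℕ → M) → ℝ}

theorem rate_eq_iSup (hR : ∀ x, 0 ≤ Rplus f V x) (x : ℕ → M) :
    rate f V x = ⨆ n : ℕ, ENNReal.ofReal (birkhoffSum shift (Rplus f V) n x) := by
  rw [rate, ENNReal.tsum_eq_iSup_nat]
  congr 1
  funext n
  rw [birkhoffSum, ENNReal.ofReal_sum_of_nonneg fun _ _ => hR _]

theorem exists_lt_birkhoffSum (hR : ∀ x, 0 ≤ Rplus f V x) {L : ℝ} {x : ℕ → M}
    (h : (L : EReal) < (rate f V x : EReal)) : ∃ n, L < birkhoffSum shift (Rplus f V) n x := by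
  by_contra! hle
  -- The empty sum, `n = 0`, disposes of negative `L`, for which `ENNReal.ofReal` would lose
  -- information.
  have hL : 0 ≤ L := by simpa using hle 0
  refine absurd h (not_lt.2 ?_)
  have h1 : rate f V x ≤ ENNReal.ofReal L := by
    rw [rate_eq_iSup hR]
    exact iSup_le fun n => ENNReal.ofReal_le_ofReal (hle n)
  calc (rate f V x : EReal) ≤ (ENNReal.ofReal L : EReal) := by exact_mod_cast h1
    _ = L := by rw [EReal.coe_ennreal_ofReal, max_eq_left hL]

theorem birkhoffSum_le_toReal_rate (hR : ∀ x, 0 ≤ Rplus f V x) {x : ℕ → M}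
    (hx : rate f V x ≠ ⊤) (n : ℕ) :
    birkhoffSum shift (Rplus f V) n x ≤ (rate f V x).toReal := by
  rw [← ENNReal.ofReal_le_iff_le_toReal hx, rate_eq_iSup hR]
  exact le_iSup (fun n => ENNReal.ofReal (birkhoffSum shift (Rplus f V) n x)) n

theorem continuous_birkhoffSum {M : Type*} [TopologicalSpace M] {g : (ℕ → M) → ℝ}
    (hg : Continuous g) (n : ℕ) : Continuous (birkhoffSum shift g n) :=
  continuous_finsetSum _ fun i _ => hg.comp (continuous_shift.iterate i)

theorem lowerSemicontinuous_rate [TopologicalSpace M] (hR : Continuous (Rplus f V)) :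
    LowerSemicontinuous (rate f V) :=
  lowerSemicontinuous_tsum fun i => (ENNReal.continuous_ofReal.comp
    (hR.comp (continuous_shift.iterate i))).lowerSemicontinuous

end Rate

theorem abs_birkhoffSum_add_le {M : Type*} {g R : (ℕ → M) → ℝ} {b η : ℝ}
    (h : ∀ x, |b * g x + R x| ≤ η) (n : ℕ) (x : ℕ → M) :
    |b * birkhoffSum shift g n x + birkhoffSum shift R n x| ≤ n * η := by
  simp only [birkhoffSum]
  rw [Finset.mul_sum, ← Finset.sum_add_distrib]
  refine (Finset.abs_sum_le_sum_abs _ _).trans ?_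
  calc _ ≤ ∑ _ ∈ Finset.range n, η := Finset.sum_le_sum fun i _ => h _
    _ = n * η := by simp

theorem seqDist_le_shift_iterate {M : Type*} [MetricSpace M] [CompactSpace M]
    (N : ℕ) : ∀ x y : ℕ → M, (∀ i < N, x i = y i) →
    seqDist x y ≤ seqDist (shift^[N] x) (shift^[N] y) := by
  induction N with
  | zero => intro x y _; exact le_rfl
  | succ N ih =>
    intro x y h
    have h1 := ih (shift x) (shift y) fun i hi => h (i + 1) (by omega)
    rw [Function.iterate_succ_apply, Function.iterate_succ_apply]
    rw [seqDist_eq_half_shift (h 0 (by omega))]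
    linarith [seqDist_nonneg (shift x) (shift y)]

/-! ### Upper and lower exponential bounds. -/

section Deviations

variable {M : Type*} [MetricSpace M] [CompactSpace M] [MeasurableSpace M] [BorelSpace M]
  {m : Measure M} [IsProbabilityMeasure m] {f V : (ℕ → M) → ℝ} {g : ℝ → (ℕ → M) → ℝ}
  {μ : ℝ → Measure (ℕ → M)}

/-- The sets where `S_n R₊ > L'` are open and increase with `n`, so one of them contains the compact
set `F`. The gap `L' - L` pays for replacing `-g_c / c` by `R₊` along `n` steps. -/
theorem eventually_measure_le_exp (hR : Continuous (Rplus f V)) (hR0 : ∀ x, 0 ≤ Rplus f V x)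
    (hg : ∀ c > 0, Continuous (g c)) (hprob : ∀ c > 0, IsProbabilityMeasure (μ c))
    (hstat : ∀ c > 0, IsStationary m (g c) (μ c))
    (hunif : ∀ η > 0, ∀ᶠ c in atTop, ∀ x, |c⁻¹ * g c x + Rplus f V x| ≤ η)
    {F : Set (ℕ → M)} (hF : IsClosed F) {L L' : ℝ} (hLL' : L < L')
    (hL' : ∀ x ∈ F, (L' : EReal) < (rate f V x : EReal)) :
    ∀ᶠ c in atTop, μ c F ≤ ENNReal.ofReal (Real.exp (-(c * L))) := by
  obtain ⟨n, hn⟩ : ∃ n, F ⊆ {x | L' < birkhoffSum shift (Rplus f V) n x} := by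
    refine hF.isCompact.elim_directed_cover _
      (fun n => isOpen_lt continuous_const (continuous_birkhoffSum hR n))
      (fun x hx => Set.mem_iUnion.2 (exists_lt_birkhoffSum hR0 (hL' x hx)))
      (Monotone.directed_le fun i j hij x (hx : L' < _) => hx.trans_le ?_)
    exact Finset.sum_le_sum_of_subset_of_nonneg (Finset.range_mono hij) fun _ _ _ => hR0 _
  have hη : 0 < (L' - L) / (n + 1) := div_pos (sub_pos.2 hLL') (by positivity)
  filter_upwards [eventually_gt_atTop 0, hunif _ hη] with c hc hcu
  have := hprob c hc
  refine measure_le_exp (hstat c hc) (hg c hc) n hF.measurableSet fun x hx => ?_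
  have h1 := (abs_le.1 (abs_birkhoffSum_add_le hcu n x)).2
  have h2 : L' < birkhoffSum shift (Rplus f V) n x := hn hx
  have h3 : n * ((L' - L) / (n + 1)) ≤ L' - L := by
    rw [mul_div_assoc', div_le_iff₀ (by positivity)]
    nlinarith
  rw [← mul_neg, ← inv_mul_le_iff₀ hc]
  linarith

/-- The set where `R₊ > η` has `μ_c`-mass at most `exp (-c * η / 2)`, so a weak limit is invariant
with `∫ R₊ = 0`, hence maximizing, hence `P`. The factor `1/2` leaves room to contradict the
portmanteau inequality. -/
theorem eventually_half_le_measure (hf : Continuous f)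
    (hV : IsCalibratedSubaction f V) (hg : ∀ c > 0, Continuous (g c))
    (hprob : ∀ c > 0, IsProbabilityMeasure (μ c))
    (hinv : ∀ c > 0, ∀ w : (ℕ → M) → ℝ, Continuous w →
      ∫ x, w (shift x) ∂(μ c) = ∫ x, w x ∂(μ c))
    (hstat : ∀ c > 0, IsStationary m (g c) (μ c))
    (hunif : ∀ η > 0, ∀ᶠ c in atTop, ∀ x, |c⁻¹ * g c x + Rplus f V x| ≤ η)
    {P : Measure (ℕ → M)} [IsFiniteMeasure P]
    (huniq : ∀ Q ∈ invariantProbabilities M, ∫ x, f x ∂Q = maxMean f → Q = P)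
    {U : Set (ℕ → M)} (hU : IsOpen U) (hPU : P U ≠ 0) :
    ∀ᶠ c in atTop, P U / 2 ≤ μ c U := by
  refine mem_iff_ultrafilter.2 fun 𝒰 h𝒰 => ?_
  by_contra hcon
  have hcon' : ∀ᶠ c in (𝒰 : Filter ℝ), ¬ P U / 2 ≤ μ c U := Ultrafilter.eventually_not.2 hcon
  have hpos : ∀ᶠ c in (𝒰 : Filter ℝ), 0 < c := h𝒰 (eventually_gt_atTop 0)
  obtain ⟨Q, hQ, hlim, hopen⟩ := exists_weak_limit 𝒰 μ (hpos.mono hprob)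
  have hQinv : Q ∈ invariantProbabilities M := by
    refine mem_invariantProbabilities fun w hw => ?_
    refine tendsto_nhds_unique (hlim _ (hw.comp continuous_shift)) ((hlim w hw).congr' ?_)
    exact hpos.mono fun c hc => (hinv c hc w hw).symm
  have hRc : Continuous (Rplus f V) := continuous_defect (maxMean f) hf hV.1
  have hint := integral_defect (β := maxMean f) hf hV.1 hQinv
  have hnn : 0 ≤ ∫ x, defect (maxMean f) f V x ∂Q := integral_nonneg (Rplus_nonneg hV)
  have hle : ∀ η > 0, ∫ x, defect (maxMean f) f V x ∂Q ≤ 0 + η := by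
    intro η hη
    have hzero : Q {x | η < Rplus f V x} = 0 := by
      refine le_antisymm (ENNReal.le_of_forall_pos_le_add fun ε hε _ => ?_) bot_le
      refine (hopen _ (isOpen_lt continuous_const hRc) (0 + ε) ?_)
      have hsmall : Tendsto (fun c : ℝ => ENNReal.ofReal (Real.exp (-(c * (η / 2))))) atTop
          (𝓝 0) := by
        rw [← ENNReal.ofReal_zero]
        exact ENNReal.tendsto_ofReal (Real.tendsto_exp_neg_atTop_nhds_zero.comp
          (tendsto_id.atTop_mul_const (half_pos hη)))
      have hev := hsmall.eventually (gt_mem_nhds (show (0 : ℝ≥0∞) < 0 + ε by simpa using hε))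
      filter_upwards [hpos, h𝒰 hev, h𝒰 (hunif _ (half_pos hη))] with c hc hc1 hc2
      have := hprob c hc
      refine le_trans ?_ (le_of_lt hc1)
      refine measure_le_exp (hstat c hc) (hg c hc) 1
        (isOpen_lt continuous_const hRc).measurableSet fun x hx => ?_
      have h1 := (abs_le.1 (hc2 x)).2
      have h2 : η < Rplus f V x := hx
      rw [birkhoffSum_one, ← mul_neg, ← inv_mul_le_iff₀ hc]
      linarith
    have hae : ∀ᵐ x ∂Q, defect (maxMean f) f V x ≤ η := by
      rw [ae_iff]
      simp only [not_le]
      exact hzero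
    calc _ ≤ ∫ _, η ∂Q := integral_mono_ae (integrable_of_continuous hRc Q)
          (integrable_const _) hae
      _ = 0 + η := by simp
  have h0 := le_antisymm (le_of_forall_pos_le_add hle) hnn
  have hQP : Q = P := huniq Q hQinv (by linarith)
  have hhalf := hopen U hU (P U / 2) (hcon'.mono fun c hc => (not_le.1 hc).le)
  rw [hQP] at hhalf
  exact absurd hhalf (not_le.2 (ENNReal.half_lt_self hPU (measure_ne_top P U)))

theorem eventually_exp_le_measure [m.IsOpenPosMeasure] (hf : IsHolder f)
    (hV : IsCalibratedSubaction f V) (hg : ∀ c > 0, Continuous (g c))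
    (hprob : ∀ c > 0, IsProbabilityMeasure (μ c))
    (hinv : ∀ c > 0, ∀ w : (ℕ → M) → ℝ, Continuous w →
      ∫ x, w (shift x) ∂(μ c) = ∫ x, w x ∂(μ c))
    (hstat : ∀ c > 0, IsStationary m (g c) (μ c))
    (hunif : ∀ η > 0, ∀ᶠ c in atTop, ∀ x, |c⁻¹ * g c x + Rplus f V x| ≤ η)
    (hunique : ∃! μ : Measure (ℕ → M), IsMaximizing f μ)
    {A : Set (ℕ → M)} (hA : IsOpen A) {x : ℕ → M} (hx : x ∈ A) {L : ℝ}
    (hL : rate f V x < ENNReal.ofReal L) :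
    ∀ᶠ c in atTop, ENNReal.ofReal (Real.exp (-(c * L))) ≤ μ c A := by
  have hfc := continuous_of_isHolder hf
  have hR0 := Rplus_nonneg hV
  have hRc : Continuous (Rplus f V) := continuous_defect (maxMean f) hfc hV.1
  obtain ⟨C, α, hα, -, hC⟩ := hf
  obtain ⟨P, hP, huniq⟩ := hunique
  have huniq' : ∀ Q ∈ invariantProbabilities M, ∫ x, f x ∂Q = maxMean f → Q = P :=
    fun Q hQ hQf => huniq Q ⟨hQ, hQf⟩
  have hPprob := hP.1.1
  obtain ⟨p, hp⟩ := exists_mem_nhds_pos (IsProbabilityMeasure.ne_zero P)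
  have hxtop : rate f V x ≠ ⊤ := hL.ne_top
  set r := (rate f V x).toReal with hr
  have hrL : r < L := (ENNReal.lt_ofReal_iff_toReal_lt hxtop).1 hL
  -- Six errors: moving the first `N` coordinates, `V` at both ends, distortion, uniform convergence
  -- of `g_c / c`, and the constant `Z`.
  set η := (L - r) / 6 with hη
  have hηpos : 0 < η := by linarith
  have hSr := birkhoffSum_le_toReal_rate hR0 hxtop
  obtain ⟨δ₁, hδ₁, hVmod⟩ := exists_seqDist_lt_imp_abs_sub_lt hV.1 hηpos
  obtain ⟨δ₂, hδ₂, hAmod⟩ := exists_seqDist_lt_imp_mem hA hx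
  obtain ⟨δ₃, hδ₃, hdist⟩ : ∃ δ > 0, ∀ d, 0 ≤ d → d < δ →
      |C| * distortionConst α * d ^ α < η := by
    have hcont : Continuous fun d : ℝ => |C| * distortionConst α * d ^ α :=
      continuous_const.mul (Real.continuous_rpow_const hα.le)
    obtain ⟨δ, hδ, h⟩ := Metric.continuousAt_iff.1 (hcont.continuousAt (x := 0)) η hηpos
    refine ⟨δ, hδ, fun d hd0 hd => ?_⟩
    have := h (x := d) (by simpa [abs_of_nonneg hd0] using hd)
    rw [Real.zero_rpow hα.ne', mul_zero, Real.dist_eq, sub_zero] at this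
    exact (le_abs_self _).trans_lt this
  obtain ⟨δ, hδ, h2δ₁, h2δ₂, h2δ₃⟩ : ∃ δ > 0, 2 * δ ≤ δ₁ ∧ 2 * δ ≤ δ₂ / 2 ∧ 2 * δ ≤ δ₃ := by
    refine ⟨min δ₁ (min (δ₂ / 2) δ₃) / 2, by positivity, ?_, ?_, ?_⟩ <;>
      rw [mul_div_cancel₀ _ two_ne_zero]
    · exact min_le_left _ _
    · exact (min_le_right _ _).trans (min_le_left _ _)
    · exact (min_le_right _ _).trans (min_le_right _ _)
  -- `U` is fixed before the entrance time `N`, which is possible because the distortion constant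
  -- does not depend on `N`.
  set U : Set (ℕ → M) := {z | seqDist z p < δ} with hU
  have hUo : IsOpen U :=
    isOpen_lt (continuous_seqDist.comp (Continuous.prodMk_left p)) continuous_const
  have hPU : P U ≠ 0 := hp U (hUo.mem_nhds (by simpa [hU, seqDist_self] using hδ))
  have hUU : ∀ z ∈ U, ∀ w ∈ U, seqDist z w < 2 * δ := by
    intro z hz w hw
    have h1 : seqDist z p < δ := hz
    have h2 : seqDist w p < δ := hw
    rw [seqDist_comm] at h2
    linarith [seqDist_triangle z p w]
  obtain ⟨N, hN⟩ := exists_orbit_mem (β := maxMean f) hfc hV.1 huniq' hUo hPU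
    (fun i => shift^[i] x) (Or.inl fun i => (Function.iterate_succ_apply' shift i x).symm)
    (B := r) fun n => by
      rw [← Rplus_eq_defect, abs_of_nonneg (Finset.sum_nonneg fun _ _ => hR0 _)]
      exact hSr n
  obtain ⟨δ₄, hδ₄, hSmod⟩ :=
    exists_seqDist_lt_imp_abs_sub_lt (continuous_birkhoffSum hRc N) hηpos
  -- By contrast `ε` may depend on `N`: it uses the modulus of continuity of `S_N R₊`.
  set ε := min (δ₂ / 2) (δ₄ / 2) with hε
  have hεpos : 0 < ε := by positivity
  have hcyl : ∀ y : ℕ → M, (∀ i < N, y i ∈ Metric.ball (x i) ε) → shift^[N] y ∈ U →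
      y ∈ A ∧ birkhoffSum shift (Rplus f V) N y ≤ r + 4 * η := by
    intro y hy hyU
    -- The hybrid has the head of `x` and the tail of `y`: uniform continuity compares it with `y`,
    -- bounded distortion with `x`.
    set y' : ℕ → M := fun i => if i < N then x i else y i with hy'
    have hyx : ∀ i < N, y' i = x i := fun i hi => by simp [hy', hi]
    have htail : shift^[N] y' = shift^[N] y := by
      funext i
      simp [shift_iterate_apply, hy']
    have hyy' : seqDist y y' ≤ ε := by
      refine seqDist_le_of_forall fun i => ?_
      by_cases hi : i < N
      · rw [hyx i hi]
        exact (hy i hi).le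
      · simp [hy', hi, hεpos.le]
    have hd : seqDist (shift^[N] y') (shift^[N] x) < 2 * δ := by
      rw [htail]
      exact hUU _ hyU _ hN
    have hd' := (seqDist_le_shift_iterate N y' x hyx).trans_lt hd
    have hε₂ : ε ≤ δ₂ / 2 := min_le_left _ _
    have hε₄ : ε ≤ δ₄ / 2 := min_le_right _ _
    refine ⟨hAmod y ?_, ?_⟩
    · rw [seqDist_comm]
      linarith [seqDist_triangle y y' x]
    · have h1 := abs_lt.1 (hSmod y y' (by linarith))
      have h2 := abs_lt.1 (hVmod _ _ (hd.trans_le h2δ₁))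
      have h3 := abs_lt.1 (hVmod _ _ (hd'.trans_le h2δ₁))
      have h4 := birkhoffSum_sub_le hα (f := f) (C := |C|) (fun x y => (hC x y).trans
        (mul_le_mul_of_nonneg_right (le_abs_self C) (Real.rpow_nonneg (seqDist_nonneg _ _) _)))
        N y' x hyx
      have h5 := hdist _ (seqDist_nonneg (shift^[N] y') (shift^[N] x)) (hd.trans_le h2δ₃)
      have h6 : 0 ≤ |C| * distortionConst α * seqDist y' x ^ α :=
        mul_nonneg (mul_nonneg (abs_nonneg C) (distortionConst_pos hα).le)
          (Real.rpow_nonneg (seqDist_nonneg _ _) _)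
      rw [mul_sub] at h4
      have h7 := abs_le.1 h4
      have h8 := birkhoffSum_defect (maxMean f) f V N y'
      have h9 := birkhoffSum_defect (maxMean f) f V N x
      have h10 := hSr N
      rw [Rplus_eq_defect] at h1 h10 ⊢
      linarith
  -- This positive factor does not depend on `c`, so `c * η` eventually dominates `-log Z`.
  set Z : ℝ≥0∞ := (∏ i ∈ Finset.range N, m (Metric.ball (x i) ε)) * (P U / 2) with hZ
  have hZ0 : Z ≠ 0 := by
    refine mul_ne_zero (Finset.prod_ne_zero_iff.2 fun i _ => ?_) ?_
    · exact (Metric.measure_ball_pos m (x i) hεpos).ne'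
    · exact (ENNReal.half_pos hPU).ne'
  have hZtop : Z ≠ ⊤ := by
    refine ENNReal.mul_ne_top (ENNReal.prod_ne_top fun i _ => measure_ne_top _ _) ?_
    exact ENNReal.div_ne_top (measure_ne_top _ _) two_ne_zero
  have hZpos : 0 < Z.toReal := ENNReal.toReal_pos hZ0 hZtop
  have hlarge : ∀ᶠ c : ℝ in atTop, -Real.log Z.toReal < c * η :=
    (tendsto_id.atTop_mul_const hηpos).eventually_gt_atTop _
  have hηN : 0 < η / (N + 1) := by positivity
  filter_upwards [eventually_gt_atTop 0, hlarge, hunif _ hηN,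
    eventually_half_le_measure hfc hV hg hprob hinv hstat hunif huniq' hUo hPU]
    with c hc hcl hcu hcU
  have h := le_measure_of_cylinder (hstat c hc) (hg c hc) (U := U) hA.measurableSet N
    (B := fun i => Metric.ball (x i) ε) (fun i => measurableSet_ball)
    (t := -(c * (r + 5 * η))) fun y hy hyU => by
      obtain ⟨h1, h2⟩ := hcyl y hy hyU
      refine ⟨h1, ?_⟩
      have h3 := (abs_le.1 (abs_birkhoffSum_add_le hcu N y)).1
      have h4 : N * (η / (N + 1)) ≤ η := by
        rw [mul_div_assoc', div_le_iff₀ (by positivity)]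
        nlinarith
      rw [← mul_neg, ← le_inv_mul_iff₀ hc]
      linarith
  refine le_trans ?_ h
  calc ENNReal.ofReal (Real.exp (-(c * L)))
      ≤ ENNReal.ofReal (Real.exp (-(c * (r + 5 * η)) + Real.log Z.toReal)) := by
        refine ENNReal.ofReal_le_ofReal (Real.exp_le_exp.2 ?_)
        have : L = r + 6 * η := by rw [hη]; ring
        rw [this]
        linarith
    _ = ENNReal.ofReal (Real.exp (-(c * (r + 5 * η)))) * Z := by
        rw [Real.exp_add, Real.exp_log hZpos, ENNReal.ofReal_mul (Real.exp_pos _).le,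
          ENNReal.ofReal_toReal hZtop]
    _ ≤ _ := by
        rw [hZ, ← mul_assoc]
        gcongr

/-- At a constant sequence the rate sums one value of `R₊` infinitely often, so finiteness forces
`R₊ = 0` there and its Dirac mass is maximizing. Two points of `M` would then give two maximizing
probabilities. -/
theorem exists_rate_eq_top [Nontrivial M] (hV : IsCalibratedSubaction f V)
    (hunique : ∃! μ : Measure (ℕ → M), IsMaximizing f μ) : ∃ x, rate f V x = ⊤ := by
  by_contra! h
  obtain ⟨a, b, hab⟩ := exists_pair_ne M
  have key : ∀ a : M, IsMaximizing f (Measure.dirac fun _ : ℕ => a) := by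
    intro a
    have hfix : shift (fun _ : ℕ => a) = fun _ => a := rfl
    have hiter : ∀ j, shift^[j] (fun _ : ℕ => a) = fun _ => a :=
      fun j => Function.iterate_fixed hfix j
    have hR : Rplus f V (fun _ => a) = 0 := by
      by_contra hne
      refine h (fun _ => a) ?_
      simp only [rate, hiter]
      refine ENNReal.tsum_const_eq_top_of_ne_zero ?_
      simpa using lt_of_le_of_ne (Rplus_nonneg hV _) (Ne.symm hne)
    refine ⟨mem_invariantProbabilities fun w hw => ?_, ?_⟩
    · rw [integral_dirac, integral_dirac, hfix]
    · rw [integral_dirac]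
      rw [Rplus, hfix] at hR
      linarith
  have heq := hunique.unique (key a) (key b)
  rw [dirac_eq_dirac_iff] at heq
  exact hab (congrFun heq 0)

end Deviations

/-! ### Passage to logarithms and the final theorem. -/

theorem inv_mul_log_ofReal_exp {c : ℝ} (hc : 0 < c) (L : ℝ) :
    ((1 / c : ℝ) : EReal) * ENNReal.log (ENNReal.ofReal (Real.exp (-(c * L)))) =
      ((-L : ℝ) : EReal) := by
  rw [ENNReal.log_ofReal_of_pos (Real.exp_pos _), Real.log_exp, ← EReal.coe_mul]
  congr 1
  field_simp

theorem mul_log_le_mul_log {c : ℝ} (hc : 0 < c) {s t : ℝ≥0∞} (h : s ≤ t) :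
    ((1 / c : ℝ) : EReal) * ENNReal.log s ≤ ((1 / c : ℝ) : EReal) * ENNReal.log t :=
  mul_le_mul_of_nonneg_left (ENNReal.log_monotone h)
    (by exact_mod_cast (one_div_pos.2 hc).le)

end XYModel

theorem theorem2 {k : ℕ} {H : Type*} [TopologicalSpace H]
    (I : ModelWithCorners ℝ (EuclideanSpace ℝ (Fin k)) H)
    {M : Type*} [MetricSpace M] [CompactSpace M] [ConnectedSpace M]
    [ChartedSpace H M] [IsManifold I ∞ M] [MeasurableSpace M] [BorelSpace M]
    (m : Measure M) (hm : XYModel.IsLebesgueProbability I m)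
    (f : (ℕ → M) → ℝ) (hf : XYModel.IsHolder f)
    (hunique : ∃! μ : Measure (ℕ → M), XYModel.IsMaximizing f μ)
    (V : (ℕ → M) → ℝ) (hV : XYModel.IsCalibratedSubaction f V)
    (μ : ℝ → Measure (ℕ → M))
    (hμ : ∀ c : ℝ, 0 < c → XYModel.IsGibbs m (fun x => c * f x) (μ c)) :
    (∀ F : Set (ℕ → M), IsClosed F →
      limsup (fun c : ℝ => ((1 / c : ℝ) : EReal) * ENNReal.log (μ c F)) atTop ≤
        -((⨅ x ∈ F, XYModel.rate f V x : ℝ≥0∞) : EReal)) ∧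
    (∀ A : Set (ℕ → M), IsOpen A →
      -((⨅ x ∈ A, XYModel.rate f V x : ℝ≥0∞) : EReal) ≤
        liminf (fun c : ℝ => ((1 / c : ℝ) : EReal) * ENNReal.log (μ c A)) atTop) ∧
    LowerSemicontinuous (XYModel.rate f V) ∧
    (Nontrivial M → ∃ x, XYModel.rate f V x = ⊤) := by
  have := hm.1
  have := hm.isOpenPosMeasure
  have hfc := XYModel.continuous_of_isHolder hf
  have hR0 := XYModel.Rplus_nonneg hV
  have hRc : Continuous (XYModel.Rplus f V) :=
    XYModel.continuous_defect (XYModel.maxMean f) hfc hV.1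
  choose! u s hu heig hprob hinv hstat using
    fun c (hc : 0 < c) => (hμ c hc).exists_normalized (continuous_const.mul hfc)
  have hunif : ∀ η > 0, ∀ᶠ c in atTop, ∀ x, |c⁻¹ *
      XYModel.normalized (fun x => c * f x) (u c) (s c) x + XYModel.Rplus f V x| ≤ η :=
    fun η hη => XYModel.eventually_abs_normalized_add_Rplus_le hf hunique hV hu heig hη
  have hg : ∀ c > 0, Continuous (XYModel.normalized (fun x => c * f x) (u c) (s c)) :=
    fun c hc => XYModel.continuous_normalized (continuous_const.mul hfc) (hu c hc) _
  refine ⟨fun F hF => ?_, fun A hA => ?_, XYModel.lowerSemicontinuous_rate hRc,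
    fun _ => XYModel.exists_rate_eq_top hV hunique⟩
  · by_contra! h
    obtain ⟨q, hq1, hq2⟩ := EReal.lt_iff_exists_real_btwn.1 h
    -- A second intermediate real supplies the strict gap `L < L'` of the upper bound, with `L = -q`
    -- and `L' = -q'`.
    obtain ⟨q', hq'1, hq'2⟩ := EReal.lt_iff_exists_real_btwn.1 hq1
    have hqq' : -q < -q' := neg_lt_neg (EReal.coe_lt_coe_iff.1 hq'2)
    have hrate : ∀ x ∈ F, ((-q' : ℝ) : EReal) < (XYModel.rate f V x : EReal) := by
      intro x hx
      have h1 : ((-q' : ℝ) : EReal) < ((⨅ x ∈ F, XYModel.rate f V x : ℝ≥0∞) : EReal) := by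
        rw [EReal.coe_neg]
        exact EReal.neg_lt_comm.1 hq'1
      exact h1.trans_le (by exact_mod_cast iInf₂_le x hx)
    refine absurd hq2 (not_lt.2 (limsup_le_of_le (by isBoundedDefault) ?_))
    filter_upwards [eventually_gt_atTop 0,
      XYModel.eventually_measure_le_exp hRc hR0 hg hprob hstat hunif hF hqq' hrate] with c hc hcF
    have h2 := XYModel.mul_log_le_mul_log hc hcF
    rwa [XYModel.inv_mul_log_ofReal_exp hc, neg_neg] at h2
  · by_contra! h
    obtain ⟨q, hq1, hq2⟩ := EReal.lt_iff_exists_real_btwn.1 h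
    obtain ⟨x, hx, hxq⟩ : ∃ x ∈ A, XYModel.rate f V x < ENNReal.ofReal (-q) := by
      by_contra! hall
      have h1 : ENNReal.ofReal (-q) ≤ ⨅ x ∈ A, XYModel.rate f V x := le_iInf₂ hall
      have h2 : ((-q : ℝ) : EReal) ≤ ((⨅ x ∈ A, XYModel.rate f V x : ℝ≥0∞) : EReal) :=
        calc ((-q : ℝ) : EReal) ≤ (ENNReal.ofReal (-q) : EReal) := by
              rw [EReal.coe_ennreal_ofReal]
              exact_mod_cast le_max_left _ _
          _ ≤ _ := by exact_mod_cast h1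
      rw [EReal.coe_neg] at h2
      exact absurd hq2 (not_lt.2 (EReal.neg_le.1 h2))
    refine absurd hq1 (not_lt.2 (le_liminf_of_le (by isBoundedDefault) ?_))
    filter_upwards [eventually_gt_atTop 0, XYModel.eventually_exp_le_measure hf hV hg hprob hinv
      hstat hunif hunique hA hx hxq] with c hc hcA
    have h2 := XYModel.mul_log_le_mul_log hc hcA
    rwa [XYModel.inv_mul_log_ofReal_exp hc, neg_neg] at h2
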